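/- Let $\mathcal H,\mathcal G$ be complex Hilbert spaces. (A) Let $\mathcal A:\mathcal D(\mathcal A)\subset\mathcal H\to\mathcal H$ be self-adjoint (hence densely defined and closed), with compact resolvent, and semibounded: there is $c>0$ with $\langle \mathcal A x,x\rangle\ge -c\|x\|^2$ for all $x\in\mathcal D(\mathcal A)$. Let $\mathcal H^1=\mathcal D(|\mathcal A|^{1/2})$ be the completion of $\mathcal D(\mathcal A)$ with respect to $\|x\|_1^2=\|x\|^2+\||\mathcal A|^{1/2}x\|^2$, and put $\|(x,y)\|_{\mathcal H^1\times\mathcal H}^2=\|x\|_1^2+\|y\|^2$. For $w_0,w_1\in\mathcal H$, $M\in L^2(0,T)$ and $F\in C([0,T];\mathcal H)$, a solution of $$w''(t)+\mathcal A w(t)=\int_0^t M(t-s)\,\mathcal A w(s)\,ds+F(t)\quad(t\in[0,T]),\qquad w(0)=w_0,\quad w'(0)=w_1$$ is a function $w\in C^1([0,T];\mathcal H)$ with these initial values which satisfies the equation weakly, that is, for every $v\in\mathcal D(\mathcal A)$ and $t\in[0,T]$ $$\frac{d}{dt}\langle w'(t),v\rangle=-\langle w(t),\mathcal A v\rangle+\int_0^t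 M(t-s)\langle w(s),\mathcal A v\rangle\,ds+\langle F(t),v\rangle .$$ (B) Let $\mathcal B:\mathcal D(\mathcal B)\subset\mathcal H\to\mathcal G$ be a linear operator which is closed, or more generally such that its restriction to $\mathcal D(\mathcal A)\cap\mathcal D(\mathcal B)$ is closed as an operator from $\mathcal D(\mathcal A)$ with the graph norm of $\mathcal A$ to $\mathcal G$. Let $T_0\ge0$ be such that for every $T>T_0$ there is $C>0$ such that, for all $(w_0,w_1)\in\mathcal D(\mathcal A)\times\mathcal H^1$, the solution $w$ of $w''+\mathcal A w=0$ on $[0,T]$, $w(0)=w_0$, $w'(0)=w_1$, satisfies $w(t)\in\mathcal D(\mathcal B)$ for almost every $t\in(0,T)$, $\mathcal B w\in L^2(0,T;\mathcal G)$ and $$C^{-1}\|(w_0,w_1)\|_{\mathcal H^1\times\mathcal H}\le\|\mathcal B w\|_{L^2(0,T;\mathcal G)}\le C\|(w_0,w_1)\|_{\mathcal H^1\times\mathcal H}.$$ **Theorem.** Assume (A) and (B), let $T>T_0$, let $M\in H^2(0,T)$ and $\sigma\in C^1[0,T]$ be complex-valued, and let $\sigma(0)\ne0$. Then there is $C>0$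 such that for every $f\in\mathcal H$ and every solution $u$ of $$u''(t)+\mathcal A u(t)=\int_0^t M(t-s)\,\mathcal A u(s)\,ds+\sigma(t)f\quad(t\in[0,T]),\qquad u(0)=u'(0)=0,$$ one has $u(t)\in\mathcal D(\mathcal B)$ for almost every $t\in(0,T)$, $\mathcal B u\in H^1(0,T;\mathcal G)$, and $$C^{-1}\|f\|_{\mathcal H}\le\|\mathcal B u\|_{H^1(0,T;\mathcal G)}\le C\|f\|_{\mathcal H}.$$ Here $\|y\|_{H^1(0,T;\mathcal G)}^2=\|y\|_{L^2(0,T;\mathcal G)}^2+\|y'\|_{L^2(0,T;\mathcal G)}^2$ with the weak derivative $y'$. -/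

import Mathlib

open MeasureTheory Set
open scoped ContDiff

namespace Viscoelastic

section Operators

variable {H G : Type*} [NormedAddCommGroup H] [InnerProductSpace ℂ H] [CompleteSpace H]
  [NormedAddCommGroup G] [InnerProductSpace ℂ G] [CompleteSpace G]

/-- `A` is bounded from below: `⟨A x, x⟩ ≥ -c ‖x‖²` on the domain of `A`, for some `c > 0`. -/
def IsSemibounded (A : H →ₗ.[ℂ] H) : Prop :=
  ∃ c : ℝ, 0 < c ∧ ∀ x : A.domain, -c * ‖(x : H)‖ ^ 2 ≤ (inner ℂ (A x) (x : H)).re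

/-- `A` has compact resolvent: for some complex number `z` the operator `A - z` is a bijection from
the domain of `A` onto `H` whose inverse `R` is bounded and compact. -/
def HasCompactResolvent (A : H →ₗ.[ℂ] H) : Prop :=
  ∃ (z : ℂ) (R : H →L[ℂ] H), IsCompactOperator R ∧
    (∀ y : H, ∃ h : R y ∈ A.domain, A ⟨R y, h⟩ - z • R y = y) ∧
    (∀ x : A.domain, R (A x - z • (x : H)) = x)

/-- Condition (A): `A` is self-adjoint (hence densely defined and closed), has compact resolvent and
is semibounded. -/
structure ConditionA (A : H →ₗ.[ℂ] H) : Prop where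
  selfAdjoint : IsSelfAdjoint A
  compactResolvent : HasCompactResolvent A
  semibounded : IsSemibounded A

/-- The eigenspace `{x ∈ D(A) : A x = μ x}`. -/
def eigenspace (A : H →ₗ.[ℂ] H) (μ : ℝ) : Submodule ℂ H :=
  A.graph.comap (LinearMap.prod LinearMap.id ((μ : ℂ) • LinearMap.id))

/-- `‖|A|^{1/2} x‖²` for a self-adjoint operator with compact resolvent, as given by the spectral
theorem: the sum over the real numbers `μ` of `|μ| ‖P_μ x‖²`, where `P_μ` is the orthogonal projection
onto the `μ`-eigenspace of `A` (which is closed since `A` is, so that taking its closure changes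
nothing). The value is `∞` exactly if `x` is not in the domain of `|A|^{1/2}`. -/
noncomputable def absForm (A : H →ₗ.[ℂ] H) (x : H) : ENNReal :=
  ∑' μ : ℝ, ENNReal.ofReal |μ| * ‖(eigenspace A μ).topologicalClosure.starProjection x‖ₑ ^ 2

/-- Membership in `𝓗¹ = D(|A|^{1/2})`, the completion of `D(A)` with respect to `‖·‖₁`. -/
def MemH1 (A : H →ₗ.[ℂ] H) (x : H) : Prop := absForm A x ≠ ⊤

/-- `‖(x, y)‖` in `𝓗¹ × 𝓗`, where `‖x‖₁² = ‖x‖² + ‖|A|^{1/2} x‖²`. -/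
noncomputable def energyNorm (A : H →ₗ.[ℂ] H) (x y : H) : ℝ :=
  Real.sqrt (‖x‖ ^ 2 + (absForm A x).toReal + ‖y‖ ^ 2)

/-- `w ∈ C¹([0,T]; H)` is a weak solution of
`w''(t) + A w(t) = ∫₀ᵗ M(t-s) A w(s) ds + F(t)` on `[0,T]` with `w(0) = w₀` and `w'(0) = w₁`:
the equation holds after pairing with every `v ∈ D(A)`, the self-adjoint operator `A` being moved
to `v`. -/
structure IsSolution (A : H →ₗ.[ℂ] H) (T : ℝ) (M : ℝ → ℂ) (F : ℝ → H) (w₀ w₁ : H) (w : ℝ → H) :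
    Prop where
  contDiffOn : ContDiffOn ℝ 1 w (Icc 0 T)
  initial : w 0 = w₀
  initial_deriv : derivWithin w (Icc 0 T) 0 = w₁
  equation : ∀ v : A.domain, ∀ t ∈ Icc (0 : ℝ) T,
    HasDerivWithinAt (fun s => inner ℂ (v : H) (derivWithin w (Icc 0 T) s))
      (-inner ℂ (A v) (w t) + (∫ s in (0 : ℝ)..t, M (t - s) * inner ℂ (A v) (w s))
        + inner ℂ (v : H) (F t))
      (Icc 0 T) t

/-- `y = B w` as functions on `(0,T)`: for almost every `t`, `w(t) ∈ D(B)` and `B w(t) = y(t)`. -/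
def IsObservation (B : H →ₗ.[ℂ] G) (T : ℝ) (w : ℝ → H) (y : ℝ → G) : Prop :=
  ∀ᵐ t ∂(volume.restrict (Ioo 0 T)), (w t, y t) ∈ B.graph

/-- `y ∈ L²(0,T; G)`. -/
def MemL2 (T : ℝ) (y : ℝ → G) : Prop := MemLp y 2 (volume.restrict (Ioo 0 T))

/-- The norm of `L²(0,T; G)`. -/
noncomputable def l2Norm (T : ℝ) (y : ℝ → G) : ℝ := Real.sqrt (∫ t in Ioo 0 T, ‖y t‖ ^ 2)

/-- `y'` is a weak derivative of `y` on `(0,T)`, both being in `L²(0,T; G)`. So `y ∈ H¹(0,T; G)` means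
that there is such a `y'`. -/
structure HasL2WeakDeriv (T : ℝ) (y y' : ℝ → G) : Prop where
  mem : MemL2 T y
  mem_deriv : MemL2 T y'
  integral_eq : ∀ φ : ℝ → ℝ, ContDiff ℝ ∞ φ → HasCompactSupport φ → tsupport φ ⊆ Ioo 0 T →
    ∫ t in Ioo 0 T, deriv φ t • y t = -∫ t in Ioo 0 T, φ t • y' t

/-- The norm of `H¹(0,T; G)`, for a function `y` with weak derivative `y'`. -/
noncomputable def h1Norm (T : ℝ) (y y' : ℝ → G) : ℝ :=
  Real.sqrt (l2Norm T y ^ 2 + l2Norm T y' ^ 2)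

/-- `M ∈ H²(0,T)`. -/
def MemH2 (T : ℝ) (M : ℝ → ℂ) : Prop :=
  ∃ M' M'' : ℝ → ℂ, HasL2WeakDeriv T M M' ∧ HasL2WeakDeriv T M' M''

/-- The observability-regularity inequality
`C⁻¹ ‖(w₀,w₁)‖ ≤ ‖B w‖_{L²(0,T;G)} ≤ C ‖(w₀,w₁)‖` (norm of `𝓗¹ × 𝓗`) for the solutions of
`w'' + A w = 0`. It is demanded for the data `(w₀,w₁) ∈ D(A) × 𝓗¹`, those for which `w` is a strict
solution with values in `D(A)`. They are dense in `𝓗¹ × 𝓗`. -/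
def ObservabilityRegularity (A : H →ₗ.[ℂ] H) (B : H →ₗ.[ℂ] G) (T C : ℝ) : Prop :=
  ∀ w₀ w₁ : H, w₀ ∈ A.domain → MemH1 A w₁ →
    ∀ w : ℝ → H, IsSolution A T (fun _ => 0) (fun _ => 0) w₀ w₁ w →
      ∃ y : ℝ → G, IsObservation B T w y ∧ MemL2 T y ∧
        C⁻¹ * energyNorm A w₀ w₁ ≤ l2Norm T y ∧ l2Norm T y ≤ C * energyNorm A w₀ w₁

/-- Condition (B), with the critical time `T₀`. The operator `B` is closed as an operator on `D(A)`
with the graph norm of `A`: if `xₖ ∈ D(A) ∩ D(B)`, `xₖ → x`, `A xₖ → z` and `B xₖ → y`, then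
`x ∈ D(B)` and `B x = y` (and `x ∈ D(A)`, `A x = z`, which is automatic as `A` is closed). Every closed
operator `B` from `H` to `G` has this property, and so do the trace operators which are bounded on `D(A)`
but not closable in `H`. -/
structure ConditionB (A : H →ₗ.[ℂ] H) (B : H →ₗ.[ℂ] G) (T₀ : ℝ) : Prop where
  closed : IsClosed {p : (H × H) × G | p.1 ∈ A.graph ∧ (p.1.1, p.2) ∈ B.graph}
  nonneg : 0 ≤ T₀
  observability : ∀ T : ℝ, T₀ < T → ∃ C : ℝ, 0 < C ∧ ObservabilityRegularity A B T C

end Operators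

end Viscoelastic

namespace Viscoelastic

section Convolution

open scoped Convolution ENNReal
open ContinuousLinearMap (mul)

/-- `L²(0,T; ℂ)`. -/
noncomputable abbrev L2 (T : ℝ) := Lp ℂ 2 (volume.restrict (Ioo 0 T))

/-- Convolution of two functions on `(0,T)`, both extended by zero. -/
noncomputable def cutConv (T : ℝ) (k h : ℝ → ℂ) : ℝ → ℂ :=
  (indicator (Ioo 0 T) k) ⋆[mul ℂ ℂ, volume] (indicator (Ioo 0 T) h)

variable {T : ℝ} {k h l : ℝ → ℂ}

theorem indicator_Ioo_congr {k k' : ℝ → ℂ} (hk : k =ᵐ[volume.restrict (Ioo 0 T)] k') :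
    indicator (Ioo 0 T) k =ᵐ[volume] indicator (Ioo 0 T) k' := by
  filter_upwards [(ae_restrict_iff' measurableSet_Ioo).1 hk] with t ht
  by_cases h : t ∈ Ioo 0 T
  · simp [h, ht h]
  · simp [indicator_of_notMem h]

theorem cutConv_congr {k' h' : ℝ → ℂ} (hk : k =ᵐ[volume.restrict (Ioo 0 T)] k')
    (hh : h =ᵐ[volume.restrict (Ioo 0 T)] h') : cutConv T k h = cutConv T k' h' :=
  convolution_congr _ (indicator_Ioo_congr hk) (indicator_Ioo_congr hh)

theorem cutConv_comm (k h : ℝ → ℂ) : cutConv T k h = cutConv T h k := by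
  unfold cutConv
  rw [← convolution_flip]
  congr 1
  ext
  simp

theorem memLp_indicator_Ioo {p : ℝ≥0∞} (hk : MemLp k p (volume.restrict (Ioo 0 T))) :
    MemLp (indicator (Ioo 0 T) k) p volume :=
  (memLp_indicator_iff_restrict measurableSet_Ioo).2 hk

theorem integrable_of_memLp_two {E : Type*} [NormedAddCommGroup E] {k : ℝ → E}
    (hk : MemLp k 2 (volume.restrict (Ioo 0 T))) :
    Integrable k (volume.restrict (Ioo 0 T)) :=
  hk.integrable (by norm_num)

theorem integrable_indicator_Ioo (hk : MemLp k 2 (volume.restrict (Ioo 0 T))) :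
    Integrable (indicator (Ioo 0 T) k) volume :=
  (integrable_indicator_iff measurableSet_Ioo).2 (integrable_of_memLp_two hk)

theorem memLp_two_sub_left {f : ℝ → ℂ} (hf : MemLp f 2 volume) (t : ℝ) :
    MemLp (fun s => f (t - s)) 2 volume :=
  hf.comp_measurePreserving (Measure.measurePreserving_sub_left volume t)

theorem convolutionExistsAt_of_memLp_two {f g : ℝ → ℂ} (hf : MemLp f 2 volume)
    (hg : MemLp g 2 volume) (t : ℝ) : ConvolutionExistsAt f g t (mul ℂ ℂ) volume :=
  hf.integrable_mul (memLp_two_sub_left hg t)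

theorem norm_convolution_le {f g : ℝ → ℂ} (hf : MemLp f 2 volume)
    (hg : MemLp g 2 volume) (t : ℝ) :
    ‖(f ⋆[mul ℂ ℂ, volume] g) t‖ ≤ (eLpNorm f 2 volume).toReal * (eLpNorm g 2 volume).toReal := by
  rw [convolution_mul]
  refine (norm_integral_le_lintegral_norm _).trans ?_
  rw [← ENNReal.toReal_mul]
  refine ENNReal.toReal_mono (ENNReal.mul_ne_top hf.2.ne hg.2.ne) ?_
  have h1 := eLpNorm_smul_le_mul_eLpNorm (p := 2) (q := 2) (r := 1)
    (memLp_two_sub_left hg t).1 hf.1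
  have h2 : eLpNorm (fun s => g (t - s)) 2 volume = eLpNorm g 2 volume :=
    eLpNorm_comp_measurePreserving hg.1 (Measure.measurePreserving_sub_left volume t)
  rw [h2] at h1
  refine le_trans (le_of_eq ?_) h1
  rw [eLpNorm_one_eq_lintegral_enorm]
  simp

theorem norm_cutConv_le (hk : MemLp k 2 (volume.restrict (Ioo 0 T)))
    (hh : MemLp h 2 (volume.restrict (Ioo 0 T))) (t : ℝ) :
    ‖cutConv T k h t‖ ≤ (eLpNorm k 2 (volume.restrict (Ioo 0 T))).toReal *
      (eLpNorm h 2 (volume.restrict (Ioo 0 T))).toReal := by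
  have := norm_convolution_le (memLp_indicator_Ioo hk) (memLp_indicator_Ioo hh) t
  rwa [eLpNorm_indicator_eq_eLpNorm_restrict measurableSet_Ioo,
    eLpNorm_indicator_eq_eLpNorm_restrict measurableSet_Ioo] at this

theorem aestronglyMeasurable_cutConv (hk : MemLp k 2 (volume.restrict (Ioo 0 T)))
    (hh : MemLp h 2 (volume.restrict (Ioo 0 T))) :
    AEStronglyMeasurable (cutConv T k h) volume :=
  ((integrable_indicator_Ioo hk).integrable_convolution _
    (integrable_indicator_Ioo hh)).aestronglyMeasurable

theorem memLp_cutConv (hk : MemLp k 2 (volume.restrict (Ioo 0 T)))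
    (hh : MemLp h 2 (volume.restrict (Ioo 0 T))) :
    MemLp (cutConv T k h) 2 (volume.restrict (Ioo 0 T)) :=
  MemLp.of_bound (aestronglyMeasurable_cutConv hk hh).restrict _
    (.of_forall (norm_cutConv_le hk hh))

theorem cutConv_apply (k h : ℝ → ℂ) {t : ℝ} (ht : t ∈ Icc 0 T) :
    cutConv T k h t = ∫ s in (0 : ℝ)..t, k (t - s) * h s := by
  rw [cutConv_comm, cutConv, convolution_mul, intervalIntegral.integral_of_le ht.1,
    integral_Ioc_eq_integral_Ioo, ← integral_indicator measurableSet_Ioo]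
  congr 1 with s
  by_cases hs : s ∈ Ioo 0 t
  · have h1 : s ∈ Ioo 0 T := ⟨hs.1, hs.2.trans_le ht.2⟩
    have h2 : t - s ∈ Ioo 0 T := ⟨sub_pos.2 hs.2, by linarith [hs.1, ht.2]⟩
    simp [indicator_of_mem, hs, h1, h2, mul_comm]
  · rw [indicator_of_notMem hs]
    by_cases h1 : s ∈ Ioo 0 T
    · have h2 : t - s ∉ Ioo 0 T := fun h2 => hs ⟨h1.1, by linarith [h2.1]⟩
      simp [indicator_of_notMem h2]
    · simp [indicator_of_notMem h1]

theorem cutConv_of_nonpos (k h : ℝ → ℂ) {t : ℝ} (ht : t ≤ 0) : cutConv T k h t = 0 := by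
  rw [cutConv, convolution_mul]
  refine integral_eq_zero_of_ae (.of_forall fun s => ?_)
  by_cases h1 : s ∈ Ioo 0 T
  · have h2 : t - s ∉ Ioo 0 T := fun h2 => by linarith [h2.1, h1.1]
    simp [indicator_of_notMem h2]
  · simp [indicator_of_notMem h1]

theorem cutConv_cutConv (k h l : ℝ → ℂ) {t : ℝ} (ht : t < T) :
    cutConv T (cutConv T k h) l t = (cutConv T k h ⋆[mul ℂ ℂ, volume] indicator (Ioo 0 T) l) t := by
  rw [cutConv, convolution_mul, convolution_mul]
  congr 1 with s
  by_cases h1 : t - s ∈ Ioo 0 T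
  · by_cases h2 : s ∈ Ioo 0 T
    · simp [h2]
    · have : s ≤ 0 := by
        by_contra h3
        exact h2 ⟨by linarith, by linarith [h1.1]⟩
      simp [indicator_of_notMem h2, cutConv_of_nonpos k h this]
  · simp [indicator_of_notMem h1]

theorem cutConv_assoc (hk : MemLp k 2 (volume.restrict (Ioo 0 T)))
    (hh : MemLp h 2 (volume.restrict (Ioo 0 T))) (hl : MemLp l 2 (volume.restrict (Ioo 0 T))) :
    cutConv T (cutConv T k h) l =ᵐ[volume.restrict (Ioo 0 T)] cutConv T k (cutConv T h l) := by
  have ik := integrable_indicator_Ioo hk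
  have ih := integrable_indicator_Ioo hh
  have il := integrable_indicator_Ioo hl
  have e1 := ih.norm.ae_convolution_exists (mul ℝ ℝ) il.norm
  have e2 := ik.norm.ae_convolution_exists (mul ℝ ℝ) (ih.norm.integrable_convolution (mul ℝ ℝ) il.norm)
  filter_upwards [ae_restrict_of_ae e2, ae_restrict_mem measurableSet_Ioo] with t ht htT
  rw [cutConv_cutConv _ _ _ htT.2, cutConv_comm k (cutConv T h l), cutConv_cutConv _ _ _ htT.2]
  have := convolution_assoc (mul ℂ ℂ) (mul ℂ ℂ) (mul ℂ ℂ) (mul ℂ ℂ) (fun x y z => by simp [mul_assoc])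
    ik.aestronglyMeasurable ih.aestronglyMeasurable il.aestronglyMeasurable
    (.of_forall (convolutionExistsAt_of_memLp_two (memLp_indicator_Ioo hk) (memLp_indicator_Ioo hh)))
    e1 ht
  rw [cutConv, this, ← convolution_flip]
  congr 1
  ext
  simp

theorem cutConv_add_left {k' : ℝ → ℂ} (hk : MemLp k 2 (volume.restrict (Ioo 0 T)))
    (hk' : MemLp k' 2 (volume.restrict (Ioo 0 T))) (hh : MemLp h 2 (volume.restrict (Ioo 0 T))) :
    cutConv T (k + k') h = cutConv T k h + cutConv T k' h := by
  ext t
  rw [cutConv, indicator_add']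
  exact (convolutionExistsAt_of_memLp_two (memLp_indicator_Ioo hk)
    (memLp_indicator_Ioo hh) t).add_distrib (convolutionExistsAt_of_memLp_two
    (memLp_indicator_Ioo hk') (memLp_indicator_Ioo hh) t)

theorem cutConv_smul_left (c : ℂ) (k h : ℝ → ℂ) : cutConv T (c • k) h = c • cutConv T k h := by
  have : indicator (Ioo 0 T) (c • k) = c • indicator (Ioo 0 T) k := by
    ext t; simp [indicator]
  rw [cutConv, this]
  exact smul_convolution

/-- Convolution as a bounded bilinear operation on `L²(0,T)`. -/
noncomputable def convL (T : ℝ) : L2 T →L[ℂ] L2 T →L[ℂ] L2 T :=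
  LinearMap.mkContinuous₂
    (LinearMap.mk₂ ℂ (fun k h => (memLp_cutConv (Lp.memLp k) (Lp.memLp h)).toLp)
      (fun k k' h => by
        rw [← MemLp.toLp_add]
        refine MemLp.toLp_congr _ _ (.of_eq ?_)
        rw [← cutConv_add_left (Lp.memLp k) (Lp.memLp k') (Lp.memLp h)]
        exact cutConv_congr (Lp.coeFn_add _ _) .rfl)
      (fun c k h => by
        rw [← MemLp.toLp_const_smul]
        refine MemLp.toLp_congr _ _ (.of_eq ?_)
        rw [← cutConv_smul_left]
        exact cutConv_congr (Lp.coeFn_smul _ _) .rfl)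
      (fun k h h' => by
        rw [← MemLp.toLp_add]
        refine MemLp.toLp_congr _ _ (.of_eq ?_)
        rw [cutConv_comm, cutConv_comm k, cutConv_comm k,
          ← cutConv_add_left (Lp.memLp h) (Lp.memLp h') (Lp.memLp k)]
        exact cutConv_congr (Lp.coeFn_add _ _) .rfl)
      (fun c k h => by
        rw [← MemLp.toLp_const_smul]
        refine MemLp.toLp_congr _ _ (.of_eq ?_)
        rw [cutConv_comm, cutConv_comm k, ← cutConv_smul_left]
        exact cutConv_congr (Lp.coeFn_smul _ _) .rfl))
    (((volume.restrict (Ioo 0 T)).real univ) ^ (1 / 2 : ℝ))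
    (fun k h => by
      have := Lp.norm_le_of_ae_bound (C := ‖k‖ * ‖h‖) (by positivity)
        ((memLp_cutConv (Lp.memLp k) (Lp.memLp h)).coeFn_toLp.mono fun t ht => by
          rw [ht]; exact norm_cutConv_le (Lp.memLp k) (Lp.memLp h) t)
      refine this.trans (le_of_eq ?_)
      simp only [measureUnivNNReal, Measure.real, ENNReal.toReal_ofNat, one_div, ENNReal.coe_toNNReal_eq_toReal]
      ring)

theorem convL_apply (k h : L2 T) :
    convL T k h = (memLp_cutConv (Lp.memLp k) (Lp.memLp h)).toLp := rfl

theorem coeFn_convL (k h : L2 T) :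
    convL T k h =ᵐ[volume.restrict (Ioo 0 T)] cutConv T k h :=
  MemLp.coeFn_toLp (memLp_cutConv (Lp.memLp k) (Lp.memLp h))

theorem convL_toLp (hk : MemLp k 2 (volume.restrict (Ioo 0 T)))
    (hh : MemLp h 2 (volume.restrict (Ioo 0 T))) :
    convL T hk.toLp hh.toLp = (memLp_cutConv hk hh).toLp := by
  rw [convL_apply]
  refine MemLp.toLp_congr _ _ (.of_eq ?_)
  exact cutConv_congr hk.coeFn_toLp hh.coeFn_toLp

theorem convL_comm (k h : L2 T) : convL T k h = convL T h k := by
  rw [convL_apply, convL_apply]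
  refine MemLp.toLp_congr _ _ (.of_eq ?_)
  exact cutConv_comm _ _

theorem convL_convL (k h l : L2 T) : convL T (convL T k h) l = convL T k (convL T h l) := by
  rw [convL_apply _ l, convL_apply k (convL T h l)]
  refine MemLp.toLp_congr _ _ ?_
  have h1 := cutConv_congr (h := l) (coeFn_convL k h) .rfl
  have h2 := cutConv_congr (k := k) .rfl (coeFn_convL h l)
  rw [h1, h2]
  exact cutConv_assoc (Lp.memLp k) (Lp.memLp h) (Lp.memLp l)

theorem convL_mul (k h : L2 T) : convL T k * convL T h = convL T (convL T k h) := by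
  ext1 l
  exact (convL_convL k h l).symm

theorem commute_convL (k h : L2 T) : Commute (convL T k) (convL T h) := by
  rw [Commute, SemiconjBy, convL_mul, convL_mul, convL_comm]

end Convolution

end Viscoelastic

namespace Viscoelastic

section Operators

open Filter Topology
open scoped ENNReal
open ContinuousLinearMap (mul)

variable {T : ℝ}

theorem norm_sq_eq_integral {α E : Type*} [MeasurableSpace α] {μ : Measure α}
    [NormedAddCommGroup E] [InnerProductSpace ℂ E] (h : Lp E 2 μ) :
    ‖h‖ ^ 2 = ∫ t, ‖h t‖ ^ 2 ∂μ := by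
  rw [← inner_self_eq_norm_sq (𝕜 := ℂ), L2.inner_def]
  have : ∀ t, inner ℂ (h t) (h t) = ((‖h t‖ ^ 2 : ℝ) : ℂ) := fun t => by
    rw [inner_self_eq_norm_sq_to_K]; norm_cast
  simp_rw [this]
  rw [integral_complex_ofReal]
  exact Complex.ofReal_re _

theorem memLp_continuous {p : ℝ≥0∞} (g : C(ℝ, ℂ)) : MemLp g p (volume.restrict (Ioo 0 T)) := by
  obtain ⟨c, hc⟩ := (isCompact_Icc (a := (0 : ℝ)) (b := T)).exists_bound_of_continuousOn
    g.continuous.continuousOn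
  refine MemLp.of_bound g.continuous.aestronglyMeasurable c ?_
  filter_upwards [ae_restrict_mem measurableSet_Ioo] with t ht
  exact hc t (Ioo_subset_Icc_self ht)

/-- The class in `L²(0,T)` of a continuous function. -/
noncomputable def ofCont (T : ℝ) (g : C(ℝ, ℂ)) : L2 T := (memLp_continuous g).toLp

theorem coeFn_ofCont (g : C(ℝ, ℂ)) : ofCont T g =ᵐ[volume.restrict (Ioo 0 T)] g :=
  (memLp_continuous g).coeFn_toLp

/-- Multiplication by a continuous function, as a bounded operator on `L²(0,T)`. -/
noncomputable def mulL (T : ℝ) (g : C(ℝ, ℂ)) : L2 T →L[ℂ] L2 T :=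
  (mul ℂ ℂ).holderL (volume.restrict (Ioo 0 T)) ∞ 2 2 (memLp_continuous g).toLp

theorem coeFn_mulL (g : C(ℝ, ℂ)) (h : L2 T) :
    mulL T g h =ᵐ[volume.restrict (Ioo 0 T)] fun t => g t * h t := by
  refine ((mul ℂ ℂ).coeFn_holder _ _).trans ?_
  filter_upwards [(memLp_continuous (T := T) (p := ∞) g).coeFn_toLp] with t ht
  rw [ht]; rfl

theorem mulL_mul (g g' : C(ℝ, ℂ)) : mulL T (g * g') = mulL T g * mulL T g' := by
  ext1 h
  refine Lp.ext ?_
  filter_upwards [coeFn_mulL (g * g') h, coeFn_mulL g (mulL T g' h), coeFn_mulL g' h]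
    with t h1 h2 h3
  rw [h1, mul_apply_eq_comp, h2, h3, ContinuousMap.mul_apply, mul_assoc]

theorem mulL_one : mulL T 1 = 1 := by
  ext1 h
  refine Lp.ext ?_
  filter_upwards [coeFn_mulL 1 h] with t h1
  simp [h1]

theorem commute_mulL (g g' : C(ℝ, ℂ)) : Commute (mulL T g) (mulL T g') := by
  rw [Commute, SemiconjBy, ← mulL_mul, ← mulL_mul, mul_comm]

theorem mulL_ofCont (g g' : C(ℝ, ℂ)) : mulL T g (ofCont T g') = ofCont T (g * g') := by
  refine Lp.ext ?_
  filter_upwards [coeFn_mulL g (ofCont T g'), coeFn_ofCont (T := T) g',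
    coeFn_ofCont (T := T) (g * g')] with t h1 h2 h3
  rw [h1, h2, h3, ContinuousMap.mul_apply]

/-- The exponential weight `t ↦ exp (-a t)`. -/
noncomputable def expWeight (a : ℂ) : C(ℝ, ℂ) := ⟨fun t => Complex.exp (-a * t), by fun_prop⟩

theorem expWeight_apply (a : ℂ) (t : ℝ) : expWeight a t = Complex.exp (-a * t) := rfl

theorem expWeight_mul (a b : ℂ) : expWeight a * expWeight b = expWeight (a + b) := by
  ext t
  simp only [ContinuousMap.mul_apply, expWeight_apply, ← Complex.exp_add]
  ring_nf

theorem expWeight_zero : expWeight 0 = 1 := by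
  ext t
  simp [expWeight_apply]

theorem mulL_expWeight_neg (a : ℂ) : mulL T (expWeight a) * mulL T (expWeight (-a)) = 1 := by
  rw [← mulL_mul, expWeight_mul, add_neg_cancel, expWeight_zero, mulL_one]

theorem mulL_expWeight_neg' (a : ℂ) : mulL T (expWeight (-a)) * mulL T (expWeight a) = 1 := by
  rw [← mulL_mul, expWeight_mul, neg_add_cancel, expWeight_zero, mulL_one]

theorem isUnit_mulL_expWeight (a : ℂ) : IsUnit (mulL T (expWeight a)) :=
  ⟨⟨_, _, mulL_expWeight_neg a, mulL_expWeight_neg' a⟩, rfl⟩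

/-- The Volterra integration operator. -/
noncomputable def volterra (T : ℝ) : L2 T →L[ℂ] L2 T := convL T (ofCont T 1)

/-- The coordinate function. -/
def coordFn : C(ℝ, ℂ) := ⟨fun t => (t : ℂ), by fun_prop⟩

theorem coordFn_apply (t : ℝ) : coordFn t = t := rfl

theorem coeFn_convL_toLp {k h : ℝ → ℂ} (hk : MemLp k 2 (volume.restrict (Ioo 0 T)))
    (hh : MemLp h 2 (volume.restrict (Ioo 0 T))) :
    convL T hk.toLp hh.toLp =ᵐ[volume.restrict (Ioo 0 T)]
      fun t => ∫ s in (0 : ℝ)..t, k (t - s) * h s := by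
  rw [convL_toLp]
  filter_upwards [(memLp_cutConv hk hh).coeFn_toLp, ae_restrict_mem measurableSet_Ioo] with t h1 h2
  rw [h1, cutConv_apply k h (Ioo_subset_Icc_self h2)]

theorem coeFn_convL' (k h : L2 T) :
    convL T k h =ᵐ[volume.restrict (Ioo 0 T)] fun t => ∫ s in (0 : ℝ)..t, k (t - s) * h s := by
  simpa using coeFn_convL_toLp (Lp.memLp k) (Lp.memLp h)

theorem coeFn_volterra_toLp {h : ℝ → ℂ} (hh : MemLp h 2 (volume.restrict (Ioo 0 T))) :
    volterra T hh.toLp =ᵐ[volume.restrict (Ioo 0 T)] fun t => ∫ s in (0 : ℝ)..t, h s :=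
  (coeFn_convL_toLp (memLp_continuous 1) hh).trans (by simp)

theorem coeFn_volterra (h : L2 T) :
    volterra T h =ᵐ[volume.restrict (Ioo 0 T)] fun t => ∫ s in (0 : ℝ)..t, h s := by
  simpa using coeFn_volterra_toLp (Lp.memLp h)

theorem coeFn_convL_of_ae {k h : L2 T} {k' h' : ℝ → ℂ} (hk : k =ᵐ[volume.restrict (Ioo 0 T)] k')
    (hh : h =ᵐ[volume.restrict (Ioo 0 T)] h') :
    convL T k h =ᵐ[volume.restrict (Ioo 0 T)] fun t => ∫ s in (0 : ℝ)..t, k' (t - s) * h' s := by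
  refine (coeFn_convL k h).trans ?_
  rw [cutConv_congr hk hh]
  filter_upwards [ae_restrict_mem measurableSet_Ioo] with t ht
  rw [cutConv_apply _ _ (Ioo_subset_Icc_self ht)]

theorem volterra_ofCont_one : volterra T (ofCont T 1) = ofCont T coordFn := by
  refine Lp.ext ?_
  filter_upwards [coeFn_convL_of_ae (coeFn_ofCont (T := T) 1) (coeFn_ofCont (T := T) 1),
    coeFn_ofCont (T := T) coordFn] with t h1 h2
  rw [volterra, h1, h2]
  simp [coordFn_apply]

theorem mulL_expWeight_convL (a : ℂ) (k h : L2 T) :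
    mulL T (expWeight a) (convL T k h)
      = convL T (mulL T (expWeight a) k) (mulL T (expWeight a) h) := by
  refine Lp.ext ?_
  filter_upwards [coeFn_mulL (expWeight a) (convL T k h), coeFn_convL' k h,
    coeFn_convL_of_ae (coeFn_mulL (expWeight a) k) (coeFn_mulL (expWeight a) h)] with t h1 h2 h3
  rw [h1, h2, h3, ← intervalIntegral.integral_const_mul]
  congr 1 with s
  have : expWeight a t = expWeight a (t - s) * expWeight a s := by
    simp only [expWeight_apply, ← Complex.exp_add]
    push_cast
    ring_nf
  rw [this]
  ring

theorem semiconj_mulL_expWeight (a : ℂ) (k : L2 T) :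
    mulL T (expWeight a) * convL T k = convL T (mulL T (expWeight a) k) * mulL T (expWeight a) := by
  ext1 h
  exact mulL_expWeight_convL a k h

theorem intervalIntegrable_conv (k h : L2 T) {t : ℝ} (ht : t ∈ Ioo 0 T) :
    IntervalIntegrable (fun s => k (t - s) * h s) volume 0 t := by
  have h1 := (convolutionExistsAt_of_memLp_two (memLp_indicator_Ioo (Lp.memLp h))
    (memLp_indicator_Ioo (Lp.memLp k)) t).integrable
  rw [intervalIntegrable_iff_integrableOn_Ioo_of_le ht.1.le]
  refine (h1.integrableOn (s := Ioo 0 t)).congr_fun (fun s hs => ?_) measurableSet_Ioo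
  have h1 : s ∈ Ioo 0 T := ⟨hs.1, hs.2.trans ht.2⟩
  have h2 : t - s ∈ Ioo 0 T := ⟨sub_pos.2 hs.2, by linarith [hs.1, ht.2]⟩
  simp [indicator_of_mem, h1, h2, mul_comm]

theorem mulL_coordFn_convL (k h : L2 T) :
    mulL T coordFn (convL T k h)
      = convL T (mulL T coordFn k) h + convL T k (mulL T coordFn h) := by
  refine Lp.ext ?_
  filter_upwards [coeFn_mulL coordFn (convL T k h), coeFn_convL' k h,
    coeFn_convL_of_ae (coeFn_mulL coordFn k) (.refl _ h), coeFn_convL' (mulL T coordFn k) h,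
    coeFn_convL_of_ae (.refl _ k) (coeFn_mulL coordFn h), coeFn_convL' k (mulL T coordFn h),
    Lp.coeFn_add (convL T (mulL T coordFn k) h) (convL T k (mulL T coordFn h)),
    ae_restrict_mem measurableSet_Ioo] with t h1 h2 h3 h3' h4 h4' h5 ht
  rw [h1, h2, h5, Pi.add_apply, h3, h4, ← intervalIntegral.integral_const_mul,
    ← intervalIntegral.integral_add]
  · congr 1 with s
    simp only [coordFn_apply]
    push_cast
    ring
  · have := (intervalIntegrable_conv k h ht).continuousOn_mul (g := fun s => ((t - s : ℝ) : ℂ))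
      (by fun_prop)
    refine this.congr (fun s _ => ?_)
    simp only [coordFn_apply]
    ring
  · have := (intervalIntegrable_conv k h ht).continuousOn_mul (g := fun s => (s : ℂ))
      (by fun_prop)
    refine this.congr (fun s _ => ?_)
    simp only [coordFn_apply]
    ring

theorem volterra_apply_eq_convL (h : L2 T) : volterra T h = convL T h (ofCont T 1) :=
  convL_comm _ _

theorem convL_volterra (k : L2 T) : convL T (volterra T k) = volterra T * convL T k := by
  rw [volterra, convL_mul]

theorem mulL_coordFn_volterra :
    mulL T coordFn * volterra T = volterra T * mulL T coordFn + volterra T * volterra T := by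
  ext1 h
  have h1 : mulL T coordFn (ofCont T 1) = volterra T (ofCont T 1) := by
    rw [volterra_ofCont_one, mulL_ofCont, mul_one]
  simp only [mul_apply_eq_comp, add_apply]
  conv_lhs => rw [volterra, mulL_coordFn_convL, h1, convL_volterra]
  rw [add_comm]
  rfl

theorem mulL_coordFn_one : mulL T coordFn (ofCont T 1) = volterra T (ofCont T 1) := by
  rw [volterra_ofCont_one, mulL_ofCont, mul_one]

theorem expWeight_add_volterra (a : ℂ) :
    ofCont T (expWeight a) + a • volterra T (ofCont T (expWeight a)) = ofCont T 1 := by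
  refine Lp.ext ?_
  filter_upwards [Lp.coeFn_add (ofCont T (expWeight a)) (a • volterra T (ofCont T (expWeight a))),
    Lp.coeFn_smul a (volterra T (ofCont T (expWeight a))), coeFn_ofCont (T := T) (expWeight a),
    coeFn_ofCont (T := T) 1,
    coeFn_convL_of_ae (coeFn_ofCont (T := T) 1) (coeFn_ofCont (T := T) (expWeight a))]
    with t h1 h2 h3 h4 h5
  rw [h1, Pi.add_apply, h2, h3, h4, Pi.smul_apply, volterra, h5]
  have hd : ∀ s : ℝ, HasDerivAt (fun s : ℝ => Complex.exp (-a * s)) (-a * Complex.exp (-a * s)) s :=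
    fun s => by
      have := ((hasDerivAt_id (s : ℂ)).const_mul (-a)).cexp.comp_ofReal
      simpa [mul_comm] using this
  have := intervalIntegral.integral_eq_sub_of_hasDerivAt (a := 0) (b := t) (fun s _ => hd s)
    (Continuous.intervalIntegrable (by fun_prop) _ _)
  rw [intervalIntegral.integral_const_mul] at this
  simp only [ContinuousMap.one_apply, expWeight_apply, one_mul, smul_eq_mul]
  simp only [Complex.ofReal_zero, mul_zero, Complex.exp_zero] at this
  linear_combination -this

theorem volterra_injective : Function.Injective (volterra T) := by
  rw [injective_iff_map_eq_zero]
  intro h hh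
  rcases le_or_gt T 0 with hT | hT
  · refine Lp.ext ?_
    filter_upwards [ae_restrict_mem measurableSet_Ioo] with t ht
    exact absurd (ht.1.trans ht.2) hT.not_gt
  have hint : IntervalIntegrable h volume 0 T := by
    rw [intervalIntegrable_iff_integrableOn_Ioo_of_le hT.le]
    exact integrable_of_memLp_two (Lp.memLp h)
  have h0 : (fun t => ∫ s in (0 : ℝ)..t, h s) =ᵐ[volume.restrict (Ioo 0 T)] 0 := by
    have := coeFn_volterra h
    rw [hh] at this
    exact this.symm.trans (Lp.coeFn_zero _ _ _)
  have hc : ContinuousOn (fun t => ∫ s in (0 : ℝ)..t, h s) (Ioo 0 T) := by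
    refine (intervalIntegral.continuousOn_primitive_interval' hint left_mem_uIcc).mono ?_
    rw [uIcc_of_le hT.le]
    exact Ioo_subset_Icc_self
  have h1 : EqOn (fun t => ∫ s in (0 : ℝ)..t, h s) 0 (Ioo 0 T) :=
    Measure.eqOn_open_of_ae_eq h0 isOpen_Ioo hc continuousOn_const
  refine Lp.ext ?_
  filter_upwards [ae_restrict_of_ae hint.ae_hasDerivAt_integral,
    ae_restrict_mem measurableSet_Ioo, Lp.coeFn_zero ℂ 2 (volume.restrict (Ioo 0 T))]
    with t h2 ht h3
  have h4 := h2 (by rw [uIcc_of_le hT.le]; exact Ioo_subset_Icc_self ht) 0 left_mem_uIcc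
  have h5 : HasDerivAt (fun t => ∫ s in (0 : ℝ)..t, h s) 0 t :=
    (hasDerivAt_const t (0 : ℂ)).congr_of_eventuallyEq (h1.eventuallyEq_of_mem (Ioo_mem_nhds ht.1 ht.2))
  rw [h4.unique h5, h3, Pi.zero_apply]

/-- Conjugation by the real exponential weight `exp (-γ t)`. -/
noncomputable def conjWeight (T γ : ℝ) (S : L2 T →L[ℂ] L2 T) : L2 T →L[ℂ] L2 T :=
  mulL T (expWeight γ) * S * mulL T (expWeight (-γ))

theorem conjWeight_mul (γ : ℝ) (S R : L2 T →L[ℂ] L2 T) :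
    conjWeight T γ (S * R) = conjWeight T γ S * conjWeight T γ R := by
  simp only [conjWeight, mul_assoc]
  rw [← mul_assoc (mulL T (expWeight (-γ))) (mulL T (expWeight γ)), mulL_expWeight_neg', one_mul]

theorem conjWeight_mulL (γ : ℝ) (g : C(ℝ, ℂ)) : conjWeight T γ (mulL T g) = mulL T g := by
  rw [conjWeight, (commute_mulL _ g).eq, mul_assoc, mulL_expWeight_neg, mul_one]

theorem conjWeight_convL (γ : ℝ) (k : L2 T) :
    conjWeight T γ (convL T k) = convL T (mulL T (expWeight γ) k) := by
  rw [conjWeight, semiconj_mulL_expWeight, mul_assoc, mulL_expWeight_neg, mul_one]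

theorem tendsto_mulL_expWeight (k : L2 T) :
    Tendsto (fun γ : ℝ => mulL T (expWeight γ) k) atTop (𝓝 0) := by
  rw [tendsto_zero_iff_norm_tendsto_zero]
  have h1 : Tendsto (fun γ : ℝ => ‖mulL T (expWeight γ) k‖ ^ 2) atTop (𝓝 0) := by
    have h2 : ∀ γ : ℝ, ‖mulL T (expWeight γ) k‖ ^ 2
        = ∫ t in Ioo 0 T, ‖Complex.exp (-γ * t) * k t‖ ^ 2 := fun γ => by
      rw [norm_sq_eq_integral]
      refine integral_congr_ae ?_
      filter_upwards [coeFn_mulL (expWeight γ) k] with t ht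
      rw [ht, expWeight_apply]
    simp_rw [h2]
    have h3 : Tendsto (fun γ : ℝ => ∫ t in Ioo 0 T, ‖Complex.exp (-γ * t) * k t‖ ^ 2) atTop
        (𝓝 (∫ t in Ioo 0 T, (0 : ℝ))) := by
      refine tendsto_integral_filter_of_dominated_convergence (fun t => ‖k t‖ ^ 2) ?_ ?_ ?_ ?_
      · refine .of_forall fun γ => ?_
        have : AEStronglyMeasurable (fun t : ℝ => Complex.exp (-γ * t))
            (volume.restrict (Ioo 0 T)) := by
          apply Continuous.aestronglyMeasurable; fun_prop
        exact (this.mul (Lp.aestronglyMeasurable k)).norm.pow 2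
      · filter_upwards [eventually_ge_atTop (0 : ℝ)] with γ hγ
        filter_upwards [ae_restrict_mem measurableSet_Ioo] with t ht
        rw [Real.norm_of_nonneg (by positivity), norm_mul, Complex.norm_exp]
        gcongr
        refine mul_le_of_le_one_left (norm_nonneg _) ?_
        rw [Real.exp_le_one_iff]
        have := mul_nonneg hγ ht.1.le
        simpa using this
      · exact (memLp_two_iff_integrable_sq_norm (Lp.aestronglyMeasurable k)).1 (Lp.memLp k)
      · filter_upwards [ae_restrict_mem measurableSet_Ioo] with t ht
        have h4 : Tendsto (fun γ : ℝ => (Real.exp (-(γ * t)) * ‖k t‖) ^ 2) atTop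
            (𝓝 ((0 * ‖k t‖) ^ 2)) := by
          refine Tendsto.pow (Tendsto.mul_const _ ?_) 2
          exact Real.tendsto_exp_neg_atTop_nhds_zero.comp (tendsto_id.atTop_mul_const ht.1)
        refine (h4.congr fun γ => ?_).trans (by simp)
        rw [norm_mul, Complex.norm_exp]
        simp
    simpa using h3
  have h5 := h1.sqrt
  simpa [Real.sqrt_sq] using h5

end Operators

end Viscoelastic

namespace Viscoelastic

section WeightedOperators

open Filter Topology Asymptotics

variable {T : ℝ} {S R : L2 T →L[ℂ] L2 T}

/-- The conjugates by the weights `exp (-γ t)` stay bounded as `γ → ∞`. -/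
def WeightBounded (S : L2 T →L[ℂ] L2 T) : Prop :=
  (fun γ : ℝ => conjWeight T γ S) =O[atTop] (fun _ => (1 : ℝ))

/-- The conjugates by the weights `exp (-γ t)` tend to zero as `γ → ∞`. -/
def WeightSmall (S : L2 T →L[ℂ] L2 T) : Prop :=
  (fun γ : ℝ => conjWeight T γ S) =o[atTop] (fun _ => (1 : ℝ))

theorem conjWeight_add (γ : ℝ) (S R : L2 T →L[ℂ] L2 T) :
    conjWeight T γ (S + R) = conjWeight T γ S + conjWeight T γ R := by
  simp only [conjWeight, mul_add, add_mul]

theorem conjWeight_smul (γ : ℝ) (c : ℂ) (S : L2 T →L[ℂ] L2 T) :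
    conjWeight T γ (c • S) = c • conjWeight T γ S := by
  simp only [conjWeight, mul_smul_comm, smul_mul_assoc]

theorem conjWeight_one (γ : ℝ) : conjWeight T γ 1 = 1 := by
  rw [conjWeight, mul_one, mulL_expWeight_neg]

theorem conjWeight_pow (γ : ℝ) (S : L2 T →L[ℂ] L2 T) (n : ℕ) :
    conjWeight T γ (S ^ n) = conjWeight T γ S ^ n := by
  induction n with
  | zero => simp [conjWeight_one]
  | succ n ih => rw [pow_succ, conjWeight_mul, ih, pow_succ]

namespace WeightBounded

theorem add (hS : WeightBounded S) (hR : WeightBounded R) : WeightBounded (S + R) := by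
  simp only [WeightBounded, conjWeight_add]
  exact IsBigO.add hS hR

theorem mul (hS : WeightBounded S) (hR : WeightBounded R) : WeightBounded (S * R) := by
  simp only [WeightBounded, conjWeight_mul]
  simpa using IsBigO.mul hS hR

theorem smul (c : ℂ) (hS : WeightBounded S) : WeightBounded (c • S) := by
  simp only [WeightBounded, conjWeight_smul]
  exact IsBigO.const_smul_left hS c

end WeightBounded

theorem weightBounded_mulL (g : C(ℝ, ℂ)) : WeightBounded (mulL T g) := by
  simp only [WeightBounded, conjWeight_mulL]
  exact isBigO_const_const _ one_ne_zero _

theorem weightBounded_one : WeightBounded (1 : L2 T →L[ℂ] L2 T) := by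
  rw [← mulL_one]
  exact weightBounded_mulL 1

namespace WeightSmall

theorem weightBounded (hS : WeightSmall S) : WeightBounded S := IsLittleO.isBigO hS

theorem add (hS : WeightSmall S) (hR : WeightSmall R) : WeightSmall (S + R) := by
  simp only [WeightSmall, conjWeight_add]
  exact IsLittleO.add hS hR

theorem mul_bounded (hS : WeightSmall S) (hR : WeightBounded R) : WeightSmall (S * R) := by
  simp only [WeightSmall, conjWeight_mul]
  simpa using IsLittleO.mul_isBigO hS hR

theorem bounded_mul (hS : WeightBounded S) (hR : WeightSmall R) : WeightSmall (S * R) := by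
  simp only [WeightSmall, conjWeight_mul]
  simpa using IsBigO.mul_isLittleO hS hR

theorem smul (c : ℂ) (hS : WeightSmall S) : WeightSmall (c • S) := by
  simp only [WeightSmall, conjWeight_smul]
  exact IsLittleO.const_smul_left hS c

/-- A perturbation of the identity by a small operator has a two-sided inverse, which is bounded for
the weights. -/
theorem exists_inverse (hS : WeightSmall S) :
    ∃ R : L2 T →L[ℂ] L2 T, (1 + S) * R = 1 ∧ R * (1 + S) = 1 ∧ WeightBounded R := by
  have hlim : ∀ᶠ γ : ℝ in atTop, ‖conjWeight T γ S‖ ≤ 1 / 2 := by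
    simpa using (isLittleO_iff.1 hS) (c := 1 / 2) (by norm_num)
  have hu : IsUnit (1 + S) := by
    obtain ⟨γ, hγ⟩ := hlim.exists
    have h1 : IsUnit (1 + conjWeight T γ S) := by
      have : ‖-conjWeight T γ S‖ < 1 := by rw [norm_neg]; linarith
      simpa using isUnit_one_sub_of_norm_lt_one this
    have h2 : 1 + S = mulL T (expWeight (-γ)) * (1 + conjWeight T γ S) * mulL T (expWeight γ) := by
      rw [mul_add, add_mul, mul_one, mulL_expWeight_neg', conjWeight]
      simp only [← mul_assoc, mulL_expWeight_neg', one_mul]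
      rw [mul_assoc, mulL_expWeight_neg', mul_one]
    rw [h2]
    exact ((isUnit_mulL_expWeight _).mul h1).mul (isUnit_mulL_expWeight _)
  obtain ⟨u, hu⟩ := hu
  have h1 : (1 + S) * ↑u⁻¹ = 1 := by rw [← hu]; exact u.mul_inv
  refine ⟨↑u⁻¹, h1, by rw [← hu]; exact u.inv_mul, ?_⟩
  refine IsBigO.of_bound (2 * ‖(1 : L2 T →L[ℂ] L2 T)‖) ?_
  filter_upwards [hlim] with γ hγ
  have h2 := congrArg (conjWeight T γ) h1
  rw [conjWeight_mul, conjWeight_add, conjWeight_one, add_mul, one_mul] at h2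
  have h3 : ‖conjWeight T γ ↑u⁻¹‖ ≤ ‖(1 : L2 T →L[ℂ] L2 T)‖ + 1 / 2 * ‖conjWeight T γ ↑u⁻¹‖ := by
    calc ‖conjWeight T γ ↑u⁻¹‖ = ‖1 - conjWeight T γ S * conjWeight T γ ↑u⁻¹‖ := by
          rw [← h2, add_sub_cancel_right]
      _ ≤ _ := (norm_sub_le _ _).trans (by
          gcongr
          exact (norm_mul_le _ _).trans (by gcongr))
  simp only [norm_one, mul_one]
  linarith

theorem isUnit_one_add (hS : WeightSmall S) : IsUnit (1 + S) := by
  obtain ⟨R, h1, h2, -⟩ := hS.exists_inverse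
  exact ⟨⟨_, R, h1, h2⟩, rfl⟩

end WeightSmall

theorem weightSmall_convL (k : L2 T) : WeightSmall (convL T k) := by
  simp only [WeightSmall, conjWeight_convL]
  rw [isLittleO_one_iff]
  have := ((convL T).continuous.tendsto 0).comp (tendsto_mulL_expWeight k)
  rwa [map_zero] at this

theorem weightSmall_volterra : WeightSmall (volterra T) := weightSmall_convL _

/-- The coefficients `1 / (2 ^ (j + 1) (j + 1)!)`. -/
noncomputable def transCoeff (j : ℕ) : ℂ := ((2 ^ (j + 1) * (j + 1).factorial : ℕ) : ℂ)⁻¹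

theorem norm_transCoeff_le (j : ℕ) : ‖transCoeff j‖ ≤ ((j.factorial : ℕ) : ℝ)⁻¹ := by
  rw [transCoeff, norm_inv, Complex.norm_natCast]
  gcongr
  calc j.factorial ≤ (j + 1).factorial := Nat.factorial_le (Nat.le_succ j)
    _ ≤ 2 ^ (j + 1) * (j + 1).factorial := Nat.le_mul_of_pos_left _ (by positivity)

/-- The series `∑ⱼ A ^ j C B ^ j / (2 ^ (j + 1) (j + 1)!)`. -/
noncomputable def sandwich (A C B : L2 T →L[ℂ] L2 T) : L2 T →L[ℂ] L2 T :=
  ∑' j : ℕ, transCoeff j • (A ^ j * C * B ^ j)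

theorem norm_sandwich_term_le (A C B : L2 T →L[ℂ] L2 T) (j : ℕ) :
    ‖transCoeff j • (A ^ j * C * B ^ j)‖
      ≤ (‖(1 : L2 T →L[ℂ] L2 T)‖ ^ 2 * ‖C‖) * ((‖A‖ * ‖B‖) ^ j / j.factorial) := by
  have hpow : ∀ D : L2 T →L[ℂ] L2 T, ‖D ^ j‖ ≤ ‖(1 : L2 T →L[ℂ] L2 T)‖ * ‖D‖ ^ j := fun D => by
    induction j with
    | zero => simp
    | succ j ih =>
      rw [pow_succ, pow_succ, ← mul_assoc]
      exact (norm_mul_le _ _).trans (by gcongr)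
  calc ‖transCoeff j • (A ^ j * C * B ^ j)‖ ≤ ‖transCoeff j‖ * (‖A ^ j‖ * ‖C‖ * ‖B ^ j‖) := by
        rw [norm_smul]
        gcongr
        exact (norm_mul_le _ _).trans (by gcongr; exact norm_mul_le _ _)
    _ ≤ ((j.factorial : ℕ) : ℝ)⁻¹ * ((‖(1 : L2 T →L[ℂ] L2 T)‖ * ‖A‖ ^ j) * ‖C‖ *
          (‖(1 : L2 T →L[ℂ] L2 T)‖ * ‖B‖ ^ j)) := by
        gcongr
        · exact norm_transCoeff_le j
        · exact hpow A
        · exact hpow B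
    _ = _ := by rw [mul_pow]; ring

theorem summable_sandwich (A C B : L2 T →L[ℂ] L2 T) :
    Summable fun j : ℕ => transCoeff j • (A ^ j * C * B ^ j) :=
  .of_norm_bounded ((Real.summable_pow_div_factorial _).mul_left _) (norm_sandwich_term_le A C B)

theorem norm_sandwich_le (A C B : L2 T →L[ℂ] L2 T) :
    ‖sandwich A C B‖ ≤ (‖(1 : L2 T →L[ℂ] L2 T)‖ ^ 2 * ‖C‖) * Real.exp (‖A‖ * ‖B‖) := by
  refine tsum_of_norm_bounded ?_ (norm_sandwich_term_le A C B)
  rw [Real.exp_eq_exp_ℝ]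
  exact (NormedSpace.expSeries_div_hasSum_exp (‖A‖ * ‖B‖)).mul_left _

theorem conjWeight_sandwich (γ : ℝ) (A C B : L2 T →L[ℂ] L2 T) :
    conjWeight T γ (sandwich A C B)
      = sandwich (conjWeight T γ A) (conjWeight T γ C) (conjWeight T γ B) := by
  rw [conjWeight, sandwich, ← (summable_sandwich A C B).tsum_mul_left,
    ← ((summable_sandwich A C B).mul_left _).tsum_mul_right, sandwich]
  refine tsum_congr fun j => ?_
  rw [← conjWeight_pow, ← conjWeight_pow, ← conjWeight_mul, ← conjWeight_mul, ← conjWeight_smul,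
    conjWeight]

theorem WeightBounded.sandwich {A C B : L2 T →L[ℂ] L2 T} (hA : WeightBounded A)
    (hC : WeightBounded C) (hB : WeightBounded B) : WeightBounded (sandwich A C B) := by
  obtain ⟨a, ha⟩ := hA.bound
  obtain ⟨b, hb⟩ := hB.bound
  obtain ⟨c, hc⟩ := hC.bound
  refine IsBigO.of_bound ((‖(1 : L2 T →L[ℂ] L2 T)‖ ^ 2 * c) * Real.exp (a * b)) ?_
  filter_upwards [ha, hb, hc] with γ h1 h2 h3
  rw [conjWeight_sandwich]
  simp only [norm_one, mul_one] at h1 h2 h3 ⊢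
  refine (norm_sandwich_le _ _ _).trans ?_
  have h0 := (norm_nonneg _).trans h1
  have h0 := (norm_nonneg _).trans h3
  gcongr

end WeightedOperators

section Commutators

variable {A : Type*} [Ring A] [Algebra ℂ A] {V N Q : A} {lam : ℂ}

theorem commute_inverse (hQ : (1 + lam • V ^ 2) * Q = 1) (hQ' : Q * (1 + lam • V ^ 2) = 1) :
    Commute V Q := by
  have h1 : Commute V (1 + lam • V ^ 2) :=
    (Commute.one_right _).add_right (((Commute.refl V).pow_right 2).smul_right _)
  calc V * Q = Q * (1 + lam • V ^ 2) * V * Q := by rw [hQ', one_mul]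
    _ = Q * V * ((1 + lam • V ^ 2) * Q) := by
      rw [mul_assoc Q, ← h1.eq]; simp only [mul_assoc]
    _ = Q * V := by rw [hQ, mul_one]

theorem commutator_inverse (hNV : N * V = V * N + V * V) (hQ : (1 + lam • V ^ 2) * Q = 1)
    (hQ' : Q * (1 + lam • V ^ 2) = 1) :
    N * Q = Q * N + 2 • (V * (Q * Q)) - 2 • (V * Q) := by
  have hVQ := commute_inverse hQ hQ'
  have h1 : N * (1 + lam • V ^ 2) = (1 + lam • V ^ 2) * N + 2 • (V * (1 + lam • V ^ 2 - 1)) := by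
    have hV2 : N * V ^ 2 = V ^ 2 * N + 2 • V ^ 3 := by
      rw [pow_two, ← mul_assoc, hNV, add_mul, mul_assoc V N, hNV]
      noncomm_ring
    rw [mul_add, add_mul, mul_one, one_mul, mul_smul_comm, hV2, smul_mul_assoc, smul_add,
      add_sub_cancel_left, mul_smul_comm, ← pow_succ', add_assoc, smul_comm lam 2]
  have h2 : Q * (N * (1 + lam • V ^ 2)) * Q = Q * N := by
    rw [mul_assoc, mul_assoc, hQ, mul_one]
  have h3 : Q * (V * (1 + lam • V ^ 2 - 1)) * Q = V * Q - V * (Q * Q) := by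
    rw [← mul_assoc, ← hVQ.eq, mul_assoc V, mul_sub, hQ', mul_one, mul_assoc, sub_mul, one_mul,
      mul_sub]
  rw [← h2, h1, mul_add, add_mul, ← mul_assoc Q, hQ', one_mul, mul_smul_comm, smul_mul_assoc, h3]
  abel

theorem commutator_resolvent (hNV : N * V = V * N + V * V) (hQ : (1 + lam • V ^ 2) * Q = 1)
    (hQ' : Q * (1 + lam • V ^ 2) = 1) :
    V * N * (V ^ 2 * Q) = V ^ 2 * Q * (V * N) + 2 • (V ^ 2 * Q) ^ 2 := by
  have hVQ : ∀ x, Q * (V * x) = V * (Q * x) := fun x => by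
    rw [← mul_assoc, ← (commute_inverse hQ hQ').eq, mul_assoc]
  have hNV' : ∀ x, N * (V * x) = V * (N * x) + V * (V * x) := fun x => by
    rw [← mul_assoc, hNV, add_mul, mul_assoc, mul_assoc]
  have hNQ := commutator_inverse hNV hQ hQ'
  simp only [pow_two, mul_assoc, hVQ, hNV', hNQ, mul_add, mul_sub, two_smul]
  abel

theorem commutator_resolvent_mul (hNV : N * V = V * N + V * V) (hQ : (1 + lam • V ^ 2) * Q = 1)
    (hQ' : Q * (1 + lam • V ^ 2) = 1) :
    V * N * (Q * V) = 2 • (V ^ 2 * Q * (Q * V)) + V * Q * V * (N - V) := by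
  have hVQ : ∀ x, Q * (V * x) = V * (Q * x) := fun x => by
    rw [← mul_assoc, ← (commute_inverse hQ hQ').eq, mul_assoc]
  have hVQ' : Q * V = V * Q := (commute_inverse hQ hQ').eq.symm
  have hNV' : ∀ x, N * (V * x) = V * (N * x) + V * (V * x) := fun x => by
    rw [← mul_assoc, hNV, add_mul, mul_assoc, mul_assoc]
  have hNQ := commutator_inverse hNV hQ hQ'
  simp only [pow_two, mul_assoc, hVQ', hVQ, hNV', hNQ, mul_add, mul_sub, two_smul]
  abel

/-- If `[N, V] = V²` and `N e = V e`, then with `Q = (1 + lam V²)⁻¹`, `P = V² Q` and `S = Q V e` one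
has `V N P ^ j S = 2 (j + 1) P ^ (j + 1) S`. -/
theorem moment_pow_apply {E : Type*} [NormedAddCommGroup E] [NormedSpace ℂ E] {V N Q : E →L[ℂ] E}
    {e : E} (hNV : N * V = V * N + V * V) (hNe : N e = V e) (hQ : (1 + lam • V ^ 2) * Q = 1)
    (hQ' : Q * (1 + lam • V ^ 2) = 1) (j : ℕ) :
    (V * N) (((V ^ 2 * Q) ^ j) (Q (V e)))
      = (2 * (j + 1)) • ((V ^ 2 * Q) ^ (j + 1)) (Q (V e)) := by
  induction j with
  | zero =>
    have h := congrArg (fun D : E →L[ℂ] E => D e) (commutator_resolvent_mul hNV hQ hQ')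
    simpa [hNe] using h
  | succ j ih =>
    have h : ∀ x, (V * N) ((V ^ 2 * Q) x)
        = (V ^ 2 * Q) ((V * N) x) + 2 • ((V ^ 2 * Q) ^ 2) x := fun x =>
      congrArg (fun D : E →L[ℂ] E => D x) (commutator_resolvent hNV hQ hQ')
    have hs : ((V ^ 2 * Q) ^ (j + 1)) (Q (V e)) = (V ^ 2 * Q) (((V ^ 2 * Q) ^ j) (Q (V e))) := by
      rw [pow_succ' _ j, mul_apply_eq_comp]
    rw [hs, h, ih]
    generalize Q (V e) = x
    rw [map_nsmul, ← mul_apply_eq_comp,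
      ← mul_apply_eq_comp, ← pow_succ', ← pow_add, add_comm 2 j, ← add_smul]
    congr 1

theorem moment_pow_iterate {E : Type*} [NormedAddCommGroup E] [NormedSpace ℂ E]
    {V N Q : E →L[ℂ] E}
    {e : E} (hNV : N * V = V * N + V * V) (hNe : N e = V e) (hQ : (1 + lam • V ^ 2) * Q = 1)
    (hQ' : Q * (1 + lam • V ^ 2) = 1) (j : ℕ) :
    ((V * N) ^ j) (Q (V e)) = (2 ^ j * j.factorial) • ((V ^ 2 * Q) ^ j) (Q (V e)) := by
  induction j with
  | zero => simp
  | succ j ih =>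
    rw [pow_succ', mul_apply_eq_comp, ih, map_nsmul, moment_pow_apply hNV hNe hQ hQ', smul_smul,
      Nat.factorial_succ]
    congr 1
    ring

end Commutators

end Viscoelastic

namespace Viscoelastic

section Transmutation

variable {E : Type*} [NormedAddCommGroup E] [NormedSpace ℂ E]

/-- The series `Z = ∑ⱼ k ^ j D N (V N) ^ j / (2 ^ (j + 1) (j + 1)!)` yields an operator `X = D + V₁ k Z`
which maps `S = (1 + lam V²)⁻¹ V e` to the solution of `(G² + lam V² - V² k) X S = V e`. Here
`V₁ = G⁻¹ V` satisfies `V₁ D = D V`. -/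
theorem transmutation_apply {V N Q D G V₁ k Z : E →L[ℂ] E} {e : E} {lam : ℂ}
    (hNV : N * V = V * N + V * V) (hNe : N e = V e) (hQ : (1 + lam • V ^ 2) * Q = 1)
    (hQ' : Q * (1 + lam • V ^ 2) = 1) (hGV : Commute G V) (hkV : Commute k V) (hkG : Commute k G)
    (hkV₁ : Commute k V₁) (hGD : G * (D * V) = V * D) (hV₁D : V₁ * D = D * V) (hGe : G (D e) = e)
    (hZ : HasSum (fun j : ℕ => transCoeff j • (k ^ j * (D * N) * (V * N) ^ j)) Z) :
    (G ^ 2 + lam • V ^ 2 - V ^ 2 * k) ((D + V₁ * k * Z) (Q (V e))) = V e := by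
  have hVQ := commute_inverse hQ hQ'
  have hGD' : ∀ x, G * (D * (V * x)) = V * (D * x) := fun x => by
    rw [← mul_assoc D, ← mul_assoc, hGD, mul_assoc]
  have hGV' : ∀ x, G * (V * x) = V * (G * x) := fun x => by
    rw [← mul_assoc, hGV.eq, mul_assoc]
  have hB : (G ^ 2 + lam • V ^ 2) * D = G ^ 2 * D * (1 + lam • V ^ 2) := by
    have h2 : G ^ 2 * D * V ^ 2 = V ^ 2 * D := by
      simp only [pow_two, mul_assoc, hGD, hGD', hGV']
    rw [add_mul, mul_add, mul_one, smul_mul_assoc, mul_smul_comm, h2]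
  have hBP : (G ^ 2 + lam • V ^ 2) * (D * (V ^ 2 * Q)) = V ^ 2 * D := by
    calc (G ^ 2 + lam • V ^ 2) * (D * (V ^ 2 * Q))
        = G ^ 2 * D * ((1 + lam • V ^ 2) * Q) * V ^ 2 := by
          rw [← mul_assoc, hB, (hVQ.pow_left 2).eq]; simp only [mul_assoc]
      _ = _ := by rw [hQ, mul_one]; simp only [pow_two, mul_assoc, hGD, hGD', hGV']
  set S := Q (V e) with hS
  let Y : ℕ → E := fun j => (k ^ j * D * (V ^ 2 * Q) ^ j) S
  have hY0 : Y 0 = D S := by simp [Y]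
  have hterm : ∀ j : ℕ, (V₁ * k * (transCoeff j • (k ^ j * (D * N) * (V * N) ^ j))) S
      = Y (j + 1) := fun j => by
    have h1 : V₁ * k * (k ^ j * (D * N) * (V * N) ^ j) = k ^ (j + 1) * D * (V * N) ^ (j + 1) := by
      calc V₁ * k * (k ^ j * (D * N) * (V * N) ^ j)
          = V₁ * k ^ (j + 1) * (D * N * (V * N) ^ j) := by
            rw [pow_succ' k]; simp only [mul_assoc]
        _ = k ^ (j + 1) * (V₁ * D) * (N * (V * N) ^ j) := by
            rw [← (hkV₁.pow_left (j + 1)).eq]; simp only [mul_assoc]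
        _ = _ := by rw [hV₁D, pow_succ' (V * N)]; simp only [mul_assoc]
    have h2 := moment_pow_iterate hNV hNe hQ hQ' (j + 1)
    rw [mul_smul_comm, h1, smul_apply, mul_apply_eq_comp, h2, map_nsmul, transCoeff,
      ← Nat.cast_smul_eq_nsmul ℂ, smul_smul, inv_mul_cancel₀, one_smul]
    · rfl
    · exact Nat.cast_ne_zero.2 (by positivity)
  have hsum1 : HasSum (fun j => Y (j + 1)) ((V₁ * k * Z) S) := by
    have h1 := (hZ.mul_left (V₁ * k)).mapL (ContinuousLinearMap.apply ℂ E S)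
    simp only [ContinuousLinearMap.apply_apply] at h1
    exact h1.congr_fun fun j => (hterm j).symm
  have hX : (D + V₁ * k * Z) S = Y 0 + (V₁ * k * Z) S := by rw [hY0, add_apply]
  have hsum0 : HasSum Y ((D + V₁ * k * Z) S) := by
    rw [hX, ← hasSum_nat_add_iff' 1]
    simpa using hsum1
  have hstep : ∀ j, (G ^ 2 + lam • V ^ 2) (Y (j + 1)) = (V ^ 2 * k) (Y j) := fun j => by
    have hkB : Commute (k ^ (j + 1)) (G ^ 2 + lam • V ^ 2) :=
      ((hkG.pow_pow _ _).add_right ((hkV.pow_pow _ _).smul_right _))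
    have h1 : (G ^ 2 + lam • V ^ 2) * (k ^ (j + 1) * D * (V ^ 2 * Q) ^ (j + 1))
        = V ^ 2 * k * (k ^ j * D * (V ^ 2 * Q) ^ j) := by
      calc (G ^ 2 + lam • V ^ 2) * (k ^ (j + 1) * D * (V ^ 2 * Q) ^ (j + 1))
          = k ^ (j + 1) * ((G ^ 2 + lam • V ^ 2) * (D * (V ^ 2 * Q))) * (V ^ 2 * Q) ^ j := by
            rw [pow_succ' (V ^ 2 * Q), mul_assoc (k ^ (j + 1)), ← mul_assoc, ← hkB.eq]
            simp only [mul_assoc]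
        _ = k ^ (j + 1) * V ^ 2 * (D * (V ^ 2 * Q) ^ j) := by
            rw [hBP]; simp only [mul_assoc]
        _ = _ := by
            rw [(hkV.pow_pow _ _).eq, pow_succ' k]; simp only [mul_assoc]
    exact congrArg (fun W : E →L[ℂ] E => W S) h1
  have h1 : (G ^ 2 + lam • V ^ 2) ((V₁ * k * Z) S) = (V ^ 2 * k) ((D + V₁ * k * Z) S) := by
    refine (hsum1.mapL (G ^ 2 + lam • V ^ 2)).unique ?_
    simp only [hstep]
    exact hsum0.mapL (V ^ 2 * k)
  have h2 : (D + V₁ * k * Z) S - (V₁ * k * Z) S = D S := by rw [hX, add_sub_cancel_right, hY0]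
  rw [sub_apply, ← h1, ← map_sub, h2, ← mul_apply_eq_comp, hB, hS]
  have h3 : G ^ 2 * D * (1 + lam • V ^ 2) * (Q * V) = V * (G * D) := by
    calc G ^ 2 * D * (1 + lam • V ^ 2) * (Q * V) = G ^ 2 * D * ((1 + lam • V ^ 2) * Q) * V := by
          simp only [mul_assoc]
      _ = _ := by rw [hQ, mul_one]; simp only [pow_two, mul_assoc, hGD, hGV']
  have h4 := congrArg (fun W : E →L[ℂ] E => W e) h3
  simp only [mul_apply_eq_comp, hGe] at h4 ⊢
  exact h4

end Transmutation

end Viscoelastic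

namespace Viscoelastic

section Memory

variable {T : ℝ}

theorem commute_of_inverse {A : Type*} [Monoid A] {a b c : A} (h : Commute a b) (hbc : b * c = 1)
    (hcb : c * b = 1) : Commute a c :=
  Commute.units_inv_right (u := ⟨b, c, hbc, hcb⟩) h

theorem volterra_mulL_expWeight (a : ℂ) :
    (1 + a • volterra T) * (mulL T (expWeight a) * volterra T)
      = volterra T * mulL T (expWeight a) := by
  have h1 : mulL T (expWeight a) * volterra T
      = convL T (ofCont T (expWeight a)) * mulL T (expWeight a) := by
    rw [volterra, semiconj_mulL_expWeight, mulL_ofCont, mul_one]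
  rw [h1, ← mul_assoc]
  congr 1
  have h2 := congrArg (convL T) (expWeight_add_volterra (T := T) a)
  rw [map_add, map_smul, convL_volterra] at h2
  rw [add_mul, one_mul, smul_mul_assoc, h2, volterra]

/-- For an operator `k` commuting with the Volterra operator `V` and bounded for the weights there is
an invertible `X` which maps the solution `S` of `(1 + lam V²) S = V 1` to a solution of
`((1 + a V)² + lam V² - V² k) X S = V 1`, for every `lam`. -/
theorem exists_transmutation (a : ℂ) {k : L2 T →L[ℂ] L2 T} (hk : WeightBounded k)
    (hkV : Commute k (volterra T)) :
    ∃ X X' : L2 T →L[ℂ] L2 T, IsUnit X ∧ X * volterra T = volterra T * X' ∧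
      ∀ (lam : ℂ) (Q : L2 T →L[ℂ] L2 T), (1 + lam • volterra T ^ 2) * Q = 1 →
        Q * (1 + lam • volterra T ^ 2) = 1 →
        ((1 + a • volterra T) ^ 2 + lam • volterra T ^ 2 - volterra T ^ 2 * k : L2 T →L[ℂ] L2 T)
          (X (Q (volterra T (ofCont T 1)))) = volterra T (ofCont T 1) := by
  obtain ⟨G', hG, hG', hGb⟩ := (weightSmall_volterra (T := T)).smul a |>.exists_inverse
  have hVG : Commute (volterra T) (1 + a • volterra T) :=
    (Commute.one_right _).add_right ((Commute.refl _).smul_right a)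
  have hkG : Commute k (1 + a • volterra T) :=
    (Commute.one_right _).add_right (hkV.smul_right a)
  have hVG' := commute_of_inverse hVG hG hG'
  have hkG' := commute_of_inverse hkG hG hG'
  have hV₁D : G' * volterra T * mulL T (expWeight a) = mulL T (expWeight a) * volterra T := by
    rw [mul_assoc, ← volterra_mulL_expWeight, ← mul_assoc, hG', one_mul]
  have hDb : WeightBounded (mulL T (expWeight a)) := weightBounded_mulL _
  have hNb : WeightBounded (mulL T coordFn) := weightBounded_mulL _
  have hVs := weightSmall_volterra (T := T)
  let Z := sandwich k (mulL T (expWeight a) * mulL T coordFn) (volterra T * mulL T coordFn)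
  have hZ : WeightBounded Z := hk.sandwich (hDb.mul hNb) (hVs.weightBounded.mul hNb)
  refine ⟨mulL T (expWeight a) + G' * volterra T * k * Z,
    G' * (mulL T (expWeight a) + k * Z * volterra T), ?_, ?_, fun lam Q hQ hQ' => ?_⟩
  · have hs : WeightSmall (mulL T (expWeight (-a)) * (G' * volterra T * k * Z)) :=
      WeightSmall.bounded_mul (weightBounded_mulL _)
        (((WeightSmall.bounded_mul hGb hVs).mul_bounded hk).mul_bounded hZ)
    have := (isUnit_mulL_expWeight a).mul hs.isUnit_one_add
    rwa [mul_add, mul_one, ← mul_assoc, mulL_expWeight_neg, one_mul] at this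
  · rw [add_mul, ← hV₁D, ← mul_assoc (volterra T), hVG'.eq, mul_add]
    simp only [mul_assoc]
  · refine transmutation_apply mulL_coordFn_volterra mulL_coordFn_one hQ hQ' hVG.symm hkV hkG
      (hkG'.mul_right hkV) (volterra_mulL_expWeight a) hV₁D ?_ (summable_sandwich _ _ _).hasSum
    rw [mulL_ofCont, mul_one, add_apply, one_apply_eq_self, smul_apply, expWeight_add_volterra]

/-- `1 - M *` for the kernel `M = m₀ + m₁ t + V² m`. -/
noncomputable def memoryOp (m₀ m₁ : ℂ) (m : L2 T) : L2 T →L[ℂ] L2 T :=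
  1 - (m₀ • volterra T + volterra T ^ 2 * (m₁ • 1 + convL T m))

theorem memory_equation_apply {E : Type*} [NormedAddCommGroup E] [NormedSpace ℂ E]
    {V U W C X X' Q : E →L[ℂ] E} {lam f : ℂ} {e c z z' : E} (hV : Function.Injective V)
    (hW : U * W = 1) (hW' : W * U = 1) (hVU : Commute V U) (hVW : Commute V W) (hVC : Commute V C)
    (hWC : Commute W C) (hXV : X * V = V * X') (hQ : (1 + lam • V ^ 2) * Q = 1)
    (hQ' : Q * (1 + lam • V ^ 2) = 1)
    (hX : (W + lam • V ^ 2 : E →L[ℂ] E) (X (Q (V e))) = V e)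
    (hB : Function.Injective (1 + lam • (V ^ 2 * U) : E →L[ℂ] E)) (hc : c + lam • V (V c) = e)
    (hz : z = V z') (hz' : z' = V (-(lam • U z) + f • C e)) :
    z' = f • (W * C * X) (V c) ∧ lam • z = f • W (C e - (W * C * X') c) := by
  have hcQ : V c = Q (V e) := by
    have h1 : (1 + lam • V ^ 2 : E →L[ℂ] E) c = e := by
      rw [← hc, add_apply, one_apply_eq_self, smul_apply, pow_two, mul_apply_eq_comp]
    have h2 : Q ((1 + lam • V ^ 2 : E →L[ℂ] E) c) = c := by
      rw [← mul_apply_eq_comp, hQ', one_apply_eq_self]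
    rw [← h2, h1, ← mul_apply_eq_comp, (commute_inverse hQ hQ').eq, mul_apply_eq_comp]
  have hkey : (1 + lam • (V ^ 2 * U)) * (V * (W * C))
      = V * C * (W + lam • V ^ 2) := by
    have h1 : V ^ 2 * U * (V * (W * C)) = V * C * V ^ 2 := by
      calc V ^ 2 * U * (V * (W * C))
          = V ^ 2 * V * (U * W) * C := by
            rw [mul_assoc, ← mul_assoc U, ← hVU.eq]; simp only [mul_assoc]
        _ = _ := by
            rw [hW, mul_one, ← pow_succ, pow_succ', mul_assoc, (hVC.pow_left 2).eq, mul_assoc]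
    rw [add_mul, one_mul, smul_mul_assoc, h1, mul_add, mul_smul_comm, hWC.eq]
    simp only [mul_assoc]
  have hz'eq : z' = f • (W * C * X) (V c) := by
    refine hV ?_
    rw [← hz]
    refine hB ?_
    have h1 : (1 + lam • (V ^ 2 * U) : E →L[ℂ] E) z = f • V (V (C e)) := by
      conv_lhs => rw [add_apply, one_apply_eq_self, smul_apply]
      have h2 : z = V (V (-(lam • U z) + f • C e)) := by
        rw [← hz', hz]
      rw [map_add, map_add, map_neg, map_neg, map_smul, map_smul, map_smul, map_smul] at h2
      rw [pow_two, mul_apply_eq_comp, mul_apply_eq_comp]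
      linear_combination (norm := module) h2
    rw [h1, map_smul, map_smul]
    congr 1
    have h3 := congrArg (fun D : E →L[ℂ] E => D (X (V c))) hkey
    simp only [mul_apply_eq_comp] at h3 ⊢
    rw [h3, hcQ, hX, ← mul_apply_eq_comp C, ← hVC.eq, mul_apply_eq_comp]
  refine ⟨hz'eq, ?_⟩
  have h1 : z' = V (f • (W * C * X') c) := by
    have h2 : W * C * X * V = V * (W * C * X') := by
      rw [mul_assoc, hXV, ← mul_assoc, ← (hVW.mul_right hVC).eq, mul_assoc]
    have h3 := congrArg (fun D : E →L[ℂ] E => D c) h2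
    simp only [mul_apply_eq_comp] at h3
    rw [hz'eq, map_smul]
    simp only [mul_apply_eq_comp]
    rw [h3]
  have h2 : lam • U z = f • (C e - (W * C * X') c) := by
    have := hV (h1.symm.trans hz')
    rw [smul_sub, this]
    abel
  rw [← map_smul, ← h2, map_smul, ← mul_apply_eq_comp, hW', one_apply_eq_self]

/-- The solutions of the scalar equations `z'' + lam (1 - M *) z = f σ`, `z(0) = z'(0) = 0`, with
`σ = s₀ + V s'`, have derivatives `f Y S`, where `S = V c` solves `S'' + lam S = 0`, `S(0) = 0`,
`S'(0) = 1`, and `Y` is an invertible operator which does not depend on `lam`. -/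
theorem exists_memory_transmutation (m₀ m₁ : ℂ) (m : L2 T) {s₀ : ℂ} (hs₀ : s₀ ≠ 0) (s' : L2 T) :
    ∃ Y : L2 T →L[ℂ] L2 T, IsUnit Y ∧ ∃ K : ℝ, 0 ≤ K ∧
      ∀ (lam f : ℂ) (c z z' : L2 T), c + lam • volterra T (volterra T c) = ofCont T 1 →
        z = volterra T z' →
        z' = volterra T (-(lam • memoryOp m₀ m₁ m z) + f • (s₀ • ofCont T 1 + volterra T s')) →
        z' = f • Y (volterra T c) ∧ ‖lam • z‖ ≤ K * (1 + ‖c‖) * ‖f‖ := by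
  have hVs := weightSmall_volterra (T := T)
  have hVm : Commute (volterra T) (convL T m) := commute_convL _ _
  have hVμ : Commute (volterra T) (m₁ • 1 + convL T m) :=
    ((Commute.one_right _).smul_right _).add_right hVm
  have hμb : WeightBounded (m₁ • 1 + convL T m) :=
    (weightBounded_one.smul _).add (weightSmall_convL m).weightBounded
  have hCs : WeightSmall (m₀ • volterra T + volterra T ^ 2 * (m₁ • 1 + convL T m)) := by
    refine (hVs.smul _).add ?_
    rw [pow_two]
    exact (hVs.mul_bounded hVs.weightBounded).mul_bounded hμb
  have hsm : Commute (convL T s') (convL T m) := commute_convL _ _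
  have hVs' : Commute (volterra T) (convL T s') := commute_convL _ _
  have hsμ : Commute (convL T s') (m₁ • 1 + convL T m) :=
    ((Commute.one_right _).smul_right _).add_right hsm
  obtain ⟨W, hW, hW', hWb⟩ := (hCs.smul (-1)).exists_inverse
  have hUeq : 1 + (-1 : ℂ) • (m₀ • volterra T + volterra T ^ 2 * (m₁ • 1 + convL T m))
      = memoryOp m₀ m₁ m := by rw [neg_one_smul, ← sub_eq_add_neg, memoryOp]
  rw [hUeq] at hW hW'
  generalize hμ : m₁ • 1 + convL T m = μ at *
  have hcomm : ∀ D : L2 T →L[ℂ] L2 T, Commute D (volterra T) → Commute D μ →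
      Commute D (memoryOp m₀ m₁ m) := fun D h1 h2 => by
    rw [memoryOp, hμ]
    exact (Commute.one_right _).sub_right
      ((h1.smul_right _).add_right ((h1.pow_right 2).mul_right h2))
  have hVU := hcomm _ (.refl _) hVμ
  have hVW := commute_of_inverse hVU hW hW'
  have hμU := hcomm _ hVμ.symm (.refl _)
  have hμW := commute_of_inverse hμU hW hW'
  have hsU := hcomm _ hVs'.symm hsμ
  have hsW := commute_of_inverse hsU hW hW'
  -- `W = (1 + a V)² - V² k`
  obtain ⟨k, hkW, hkb, hkV⟩ : ∃ k : L2 T →L[ℂ] L2 T,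
      W = (1 + (m₀ / 2) • volterra T) ^ 2 - volterra T ^ 2 * k ∧ WeightBounded k ∧
        Commute k (volterra T) := by
    refine ⟨(m₀ ^ 2 / 4) • 1 + (-1 : ℂ) • ((m₀ ^ 2) • W + m₀ • (volterra T * μ * W) + μ * W), ?_,
      ?_, ?_⟩
    · have h1 : W = 1 + (m₀ • volterra T + volterra T ^ 2 * μ) * W := by
        have := hW
        rw [memoryOp, hμ, sub_mul, one_mul] at this
        rw [← this]; abel
      have h2 : W = 1 + m₀ • volterra T + m₀ ^ 2 • (volterra T ^ 2 * W)
          + m₀ • (volterra T ^ 2 * (volterra T * μ * W)) + volterra T ^ 2 * (μ * W) := by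
        calc W = 1 + (m₀ • volterra T) * W + volterra T ^ 2 * μ * W := by
              conv_lhs => rw [h1, add_mul, ← add_assoc]
          _ = 1 + (m₀ • volterra T) * (1 + (m₀ • volterra T + volterra T ^ 2 * μ) * W)
              + volterra T ^ 2 * μ * W := by rw [← h1]
          _ = _ := by
              simp only [mul_add, add_mul, mul_one, smul_mul_assoc, mul_smul_comm, smul_smul,
                pow_two, mul_assoc]
              abel
      conv_lhs => rw [h2]
      simp only [mul_add, add_mul, mul_one, one_mul, smul_mul_assoc, mul_smul_comm, smul_smul,
        pow_two, smul_add]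
      module
    · refine (weightBounded_one.smul _).add (.smul _ (((hWb.smul _).add (.smul _ ?_)).add ?_))
      · exact (hVs.weightBounded.mul hμb).mul hWb
      · exact hμb.mul hWb
    · refine Commute.symm ?_
      refine ((Commute.one_right _).smul_right _).add_right (.smul_right ?_ _)
      exact ((hVW.smul_right _).add_right
        ((((Commute.refl _).mul_right hVμ).mul_right hVW).smul_right _)).add_right
          (hVμ.mul_right hVW)
  obtain ⟨X, X', hX, hXV, hXS⟩ := exists_transmutation (m₀ / 2) hkb hkV
  simp only [add_sub_right_comm, ← hkW] at hXS
  have hCe : (s₀ • 1 + convL T s' : L2 T →L[ℂ] L2 T) (ofCont T 1)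
      = s₀ • ofCont T 1 + volterra T s' := by
    rw [volterra_apply_eq_convL, add_apply, smul_apply, one_apply_eq_self]
  have hVC : Commute (volterra T) (s₀ • 1 + convL T s') :=
    ((Commute.one_right _).smul_right _).add_right hVs'
  have hUC : Commute (memoryOp m₀ m₁ m) (s₀ • 1 + convL T s') :=
    ((Commute.one_right _).smul_right _).add_right hsU.symm
  have hWC : Commute W (s₀ • 1 + convL T s') :=
    ((Commute.one_right _).smul_right _).add_right hsW.symm
  have hC : IsUnit (s₀ • 1 + convL T s' : L2 T →L[ℂ] L2 T) := by
    have h1 := ((weightSmall_convL s').smul s₀⁻¹).isUnit_one_add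
    have h2 : (s₀ • 1 + convL T s' : L2 T →L[ℂ] L2 T)
        = Units.mk0 s₀ hs₀ • (1 + s₀⁻¹ • convL T s') := by
      rw [Units.smul_mk0, smul_add, smul_smul, mul_inv_cancel₀ hs₀, one_smul]
    rw [h2]
    exact h1.smul _
  generalize hCdef : (s₀ • 1 + convL T s' : L2 T →L[ℂ] L2 T) = C at *
  rw [← hCe]
  have hWu : IsUnit W := ⟨⟨W, _, hW', hW⟩, rfl⟩
  have hUb : WeightBounded (memoryOp m₀ m₁ m) := by
    rw [← hUeq]
    exact weightBounded_one.add (hCs.smul _).weightBounded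
  generalize memoryOp m₀ m₁ m = U at *
  refine ⟨W * C * X, (hWu.mul hC).mul hX, ‖W‖ * (‖C (ofCont T 1)‖ + ‖W * C * X'‖), by positivity,
    fun lam f c z z' hc hz hz' => ?_⟩
  have hV2s : WeightSmall (volterra T ^ 2) := by
    rw [pow_two]
    exact hVs.mul_bounded hVs.weightBounded
  obtain ⟨Q, hQ, hQ', -⟩ := (hV2s.smul lam).exists_inverse
  have hB : Function.Injective (1 + lam • (volterra T ^ 2 * U) : L2 T →L[ℂ] L2 T) := by
    obtain ⟨R, -, hR, -⟩ := ((hV2s.mul_bounded hUb).smul lam).exists_inverse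
    refine Function.LeftInverse.injective (g := R) fun x => ?_
    rw [← mul_apply_eq_comp, hR, one_apply_eq_self]
  obtain ⟨h1, h3⟩ := memory_equation_apply volterra_injective hW hW' hVU hVW hVC hWC hXV hQ hQ'
    (hXS lam Q hQ hQ') hB hc hz hz'
  refine ⟨h1, ?_⟩
  have h4 := (W * C * X').le_opNorm c
  have h5 : ‖C (ofCont T 1) - (W * C * X') c‖
      ≤ (‖C (ofCont T 1)‖ + ‖W * C * X'‖) * (1 + ‖c‖) := by
    refine (norm_sub_le _ _).trans ?_
    nlinarith [norm_nonneg (C (ofCont T 1)), norm_nonneg (W * C * X'), norm_nonneg c,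
      mul_nonneg (norm_nonneg (C (ofCont T 1))) (norm_nonneg c)]
  rw [h3, norm_smul, mul_comm, mul_assoc ‖W‖]
  exact mul_le_mul_of_nonneg_right ((W.le_opNorm _).trans
    (mul_le_mul_of_nonneg_left h5 (norm_nonneg W))) (norm_nonneg f)

end Memory

end Viscoelastic

namespace Viscoelastic

section Spectral

universe u

variable {H : Type u} [NormedAddCommGroup H] [InnerProductSpace ℂ H] {A : H →ₗ.[ℂ] H}

theorem IsSemibounded.exists_graph (hA : IsSemibounded A) :
    ∃ c : ℝ, 0 < c ∧ ∀ p ∈ A.graph, -c * ‖p.1‖ ^ 2 ≤ (inner ℂ p.2 p.1).re := by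
  obtain ⟨c, hc, h⟩ := hA
  refine ⟨c, hc, fun p hp => ?_⟩
  obtain ⟨x, hx, hx'⟩ := (LinearPMap.mem_graph_iff A).1 hp
  rw [← hx, ← hx']
  exact h x

variable [CompleteSpace H]

theorem inner_graph_eq (hA : IsSelfAdjoint A) {p q : H × H} (hp : p ∈ A.graph)
    (hq : q ∈ A.graph) : inner ℂ p.2 q.1 = inner ℂ p.1 q.2 := by
  obtain ⟨x, hx, hx'⟩ := (LinearPMap.mem_graph_iff A).1 hp
  obtain ⟨y, hy, hy'⟩ := (LinearPMap.mem_graph_iff A).1 hq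
  have h := LinearPMap.adjoint_isFormalAdjoint (T := A) hA.dense_domain
  rw [LinearPMap.isSelfAdjoint_def.1 hA] at h
  rw [← hx, ← hx', ← hy, ← hy']
  exact h x y

/-- A semibounded self-adjoint operator with compact resolvent has a compact symmetric resolvent at
some real point. -/
theorem ConditionA.exists_symmetric_resolvent (hA : ConditionA A) :
    ∃ (k : ℝ) (R : H →L[ℂ] H), IsCompactOperator R ∧ (R : H →ₗ[ℂ] H).IsSymmetric ∧
      ∀ y, (R y, y - (k : ℂ) • R y) ∈ A.graph := by
  obtain ⟨c, hc, hsb⟩ := hA.semibounded.exists_graph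
  obtain ⟨z, R, hR, h1, h2⟩ := hA.compactResolvent
  have hgr : ∀ y, (R y, y + z • R y) ∈ A.graph := fun y => by
    obtain ⟨h, hy⟩ := h1 y
    rw [LinearPMap.mem_graph_iff]
    exact ⟨⟨R y, h⟩, rfl, eq_add_of_sub_eq hy⟩
  have hpos : ∀ p ∈ A.graph, p.2 = -((c + 1 : ℝ) : ℂ) • p.1 → p.1 = 0 := fun p hp h => by
    have h3 := hsb p hp
    have h4 : (inner ℂ p.2 p.1).re = -(c + 1) * ‖p.1‖ ^ 2 := by
      have h5 := inner_self_eq_norm_sq_to_K (𝕜 := ℂ) p.1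
      rw [h, inner_smul_left, h5]
      have : (starRingEnd ℂ) (-((c + 1 : ℝ) : ℂ)) * ((‖p.1‖ : ℂ)) ^ 2
          = ((-(c + 1) * ‖p.1‖ ^ 2 : ℝ) : ℂ) := by
        rw [map_neg, Complex.conj_ofReal]; push_cast; ring
      exact (congrArg Complex.re this).trans (Complex.ofReal_re _)
    have h6 : ‖p.1‖ ^ 2 ≤ 0 := by nlinarith
    have h7 : ‖p.1‖ = 0 := by nlinarith [norm_nonneg p.1]
    exact norm_eq_zero.1 h7
  set w : ℂ := z + ((c + 1 : ℝ) : ℂ) with hw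
  have hunit : IsUnit (1 + w • R) := by
    rcases IsCompactOperator.hasEigenvalue_or_mem_resolventSet
      (T := w • R) (hR.smul w) (μ := (-1 : ℂ)) (by norm_num) with h | h
    · exfalso
      obtain ⟨v, hv, hv0⟩ := h.exists_hasEigenvector
      rw [Module.End.mem_eigenspace_iff] at hv
      have hv' : w • R v = -v := by simpa using hv
      have h3 : v = -(w • R v) := by rw [hv', neg_neg]
      have h4 : R v = 0 := hpos _ (hgr v) (by
        have : v + z • R v = -(w • R v) + z • R v := by rw [← h3]
        rw [this, hw]
        module)
      exact hv0 (by rw [h3, h4, smul_zero, neg_zero])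
    · rw [resolventSet, mem_ofPred_eq] at h
      have := h.neg
      rwa [map_neg, map_one, neg_sub, sub_neg_eq_add, add_comm] at this
  obtain ⟨u, hu⟩ := hunit
  have hu1 : ∀ y, (u⁻¹ : (H →L[ℂ] H)ˣ).val (R y)
      + w • R ((u⁻¹ : (H →L[ℂ] H)ˣ).val (R y)) = R y := fun y => by
    have : ((1 + w • R) * (u⁻¹ : (H →L[ℂ] H)ˣ).val) (R y) = R y := by
      rw [← hu, u.mul_inv, one_apply_eq_self]
    simpa using this
  set R₀ : H →L[ℂ] H := (u⁻¹ : (H →L[ℂ] H)ˣ).val * R with hR₀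
  have hgr₀ : ∀ y, (R₀ y, y - ((c + 1 : ℝ) : ℂ) • R₀ y) ∈ A.graph := fun y => by
    have h3 : R₀ y = R (y - w • R₀ y) := by
      rw [map_sub, map_smul, eq_sub_iff_add_eq]
      exact hu1 y
    have h4 := hgr (y - w • R₀ y)
    rw [← h3] at h4
    convert h4 using 2
    rw [hw]
    module
  refine ⟨c + 1, R₀, hR.clm_comp _, fun x y => ?_, hgr₀⟩
  have h3 := inner_graph_eq hA.selfAdjoint (hgr₀ x) (hgr₀ y)
  simp only [inner_sub_left, inner_sub_right, inner_smul_left, inner_smul_right,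
    Complex.conj_ofReal] at h3
  exact (sub_left_inj.1 h3).symm

theorem exists_hilbertBasis_eigenvectors {R : H →L[ℂ] H} (hR : IsCompactOperator R)
    (hR' : (R : H →ₗ[ℂ] H).IsSymmetric) :
    ∃ (ι : Type u) (b : HilbertBasis ι ℂ H) (μ : ι → ℂ), ∀ i, R (b i) = μ i • b i := by
  have hcl : ∀ μ : ℂ, CompleteSpace (Module.End.eigenspace (R : Module.End ℂ H) μ) := fun μ => by
    have : IsClosed (Module.End.eigenspace (R : Module.End ℂ H) μ : Set H) := by
      have : (Module.End.eigenspace (R : Module.End ℂ H) μ : Set H) = {x | R x = μ • x} := by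
        ext x; exact Module.End.mem_eigenspace_iff
      rw [this]
      exact isClosed_eq R.continuous (continuous_const_smul μ)
    exact this.completeSpace_coe
  choose w v hv using fun μ : ℂ => exists_hilbertBasis ℂ (Module.End.eigenspace (R : Module.End ℂ H) μ)
  have hon := hR'.orthogonalFamily_eigenspaces.orthonormal_sigma_orthonormal
    (v_family := fun μ => v μ) (fun μ => (v μ).orthonormal)
  refine ⟨Σ μ : ℂ, w μ, HilbertBasis.mkOfOrthogonalEqBot hon ?_, fun i => i.1, fun i => ?_⟩
  · rw [eq_bot_iff, ← ContinuousLinearMap.orthogonalComplement_iSup_eigenspaces_eq_bot hR hR']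
    intro x hx
    rw [Submodule.mem_orthogonal] at hx ⊢
    have h1 : ∀ μ, Module.End.eigenspace (R : Module.End ℂ H) μ ≤ (ℂ ∙ x)ᗮ := fun μ => by
      intro y hy
      rw [Submodule.mem_orthogonal_singleton_iff_inner_left]
      have h2 := ((v μ).hasSum_repr ⟨y, hy⟩).mapL (Module.End.eigenspace (R : Module.End ℂ H) μ).subtypeL
      have h3 := h2.mapL (innerSL ℂ x)
      have h4 : inner ℂ x y = 0 := by
        refine h3.unique ?_
        convert hasSum_zero with i
        have h5 := hx (v μ i) (Submodule.subset_span ⟨⟨μ, i⟩, rfl⟩)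
        simp [inner_eq_zero_symm.1 h5]
      exact inner_eq_zero_symm.1 h4
    intro y hy
    have := (iSup_le h1) hy
    rwa [Submodule.mem_orthogonal_singleton_iff_inner_left] at this
  · rw [HilbertBasis.coe_mkOfOrthogonalEqBot]
    exact Module.End.mem_eigenspace_iff.1 (v i.1 i.2).2

/-- The eigenvectors of a semibounded self-adjoint operator with compact resolvent form an
orthonormal basis, and the eigenvalues are bounded from below. -/
theorem ConditionA.exists_eigenbasis (hA : ConditionA A) :
    ∃ (ι : Type u) (b : HilbertBasis ι ℂ H) (lam : ι → ℝ) (c : ℝ), 0 ≤ c ∧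
      ∀ i, (b i, (lam i : ℂ) • b i) ∈ A.graph ∧ -c ≤ lam i := by
  obtain ⟨c, hc, hsb⟩ := hA.semibounded.exists_graph
  obtain ⟨k, R, hR, hR', hgr⟩ := hA.exists_symmetric_resolvent
  obtain ⟨ι, b, μ, hb⟩ := exists_hilbertBasis_eigenvectors hR hR'
  have hb0 : ∀ i, b i ≠ 0 := fun i => b.orthonormal.ne_zero i
  have hnorm : ∀ i, ‖b i‖ = 1 := fun i => b.orthonormal.norm_eq_one i
  have hμ : ∀ i, μ i ≠ 0 := fun i h => by
    have h1 := hgr (b i)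
    rw [hb i, h, zero_smul, smul_zero, sub_zero] at h1
    exact hb0 i ((LinearPMap.graph_fst_eq_zero_snd A h1 rfl))
  have hη : ∀ i, (b i, ((μ i)⁻¹ - k) • b i) ∈ A.graph := fun i => by
    have h1 := A.graph.smul_mem (μ i)⁻¹ (hgr (b i))
    rw [hb i] at h1
    convert h1 using 1
    rw [Prod.smul_mk, smul_smul, inv_mul_cancel₀ (hμ i), one_smul, smul_sub, sub_smul,
      smul_comm, smul_smul _ _ (b i), inv_mul_cancel₀ (hμ i), one_smul]
  have hreal : ∀ i, (((μ i)⁻¹ - k).re : ℂ) = (μ i)⁻¹ - k := fun i => by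
    have h1 := inner_graph_eq hA.selfAdjoint (hη i) (hη i)
    simp only [inner_smul_left, inner_smul_right, inner_self_eq_norm_sq_to_K, hnorm i] at h1
    exact Complex.conj_eq_iff_re.1 (by simpa using h1)
  refine ⟨ι, b, fun i => ((μ i)⁻¹ - k).re, c, hc.le, fun i => ⟨?_, ?_⟩⟩
  · rw [hreal i]
    exact hη i
  · have h1 := hsb _ (hη i)
    simp only [inner_smul_left, inner_self_eq_norm_sq_to_K, hnorm i] at h1
    rw [← hreal i, Complex.conj_ofReal] at h1
    simpa using h1

end Spectral

end Viscoelastic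

namespace Viscoelastic

section WeakDerivative

variable {T : ℝ}

theorem integrable_continuous_smul {E : Type*} [NormedAddCommGroup E] [NormedSpace ℝ E]
    {ψ : ℝ → ℝ} (hψ : Continuous ψ) {d : ℝ → E} (hd : Integrable d (volume.restrict (Ioo 0 T))) :
    Integrable (fun t => ψ t • d t) (volume.restrict (Ioo 0 T)) := by
  obtain ⟨C, hC⟩ := (isCompact_Icc (a := (0 : ℝ)) (b := T)).exists_bound_of_continuousOn
    hψ.continuousOn
  refine hd.bdd_smul C hψ.aestronglyMeasurable ?_
  filter_upwards [ae_restrict_mem measurableSet_Ioo] with t ht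
  exact hC t (Ioo_subset_Icc_self ht)

theorem integral_deriv_mul_primitive {φ : ℝ → ℝ} (hφ : ContDiff ℝ ∞ φ) (hφT : φ T = 0)
    {h : ℝ → ℂ} (hh : Integrable h (volume.restrict (Ioo 0 T))) :
    ∫ t in Ioo 0 T, deriv φ t • ∫ s in (0 : ℝ)..t, h s = -∫ t in Ioo 0 T, φ t • h t := by
  have hφ' : Continuous (deriv φ) := hφ.continuous_deriv (by simp)
  have hφi : Integrable (deriv φ) (volume.restrict (Ioo 0 T)) :=
    hφ'.integrableOn_Icc.mono_set Ioo_subset_Icc_self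
  let F : ℝ → ℝ → ℂ := fun t s => {p : ℝ × ℝ | p.2 < p.1}.indicator (fun p => deriv φ p.1 • h p.2) (t, s)
  have hF : Integrable (Function.uncurry F)
      ((volume.restrict (Ioo 0 T)).prod (volume.restrict (Ioo 0 T))) := by
    have h1 := hφi.smul_prod hh
    exact h1.indicator (measurableSet_lt measurable_snd measurable_fst)
  have h1 := integral_integral_swap hF
  have h2 : ∫ t in Ioo 0 T, ∫ s in Ioo 0 T, F t s
      = ∫ t in Ioo 0 T, deriv φ t • ∫ s in (0 : ℝ)..t, h s := by
    refine setIntegral_congr_fun measurableSet_Ioo fun t ht => ?_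
    rw [intervalIntegral.integral_of_le ht.1.le, integral_Ioc_eq_integral_Ioo,
      ← integral_smul]
    have h3 : Ioo 0 T ∩ Iio t = Ioo 0 t := by
      ext s; simp only [mem_inter_iff, mem_Ioo, mem_Iio]
      exact ⟨fun h => ⟨h.1.1, h.2⟩, fun h => ⟨⟨h.1, h.2.trans ht.2⟩, h.2⟩⟩
    rw [← h3, ← setIntegral_indicator measurableSet_Iio]
    rfl
  have h3 : ∫ s in Ioo 0 T, ∫ t in Ioo 0 T, F t s = -∫ t in Ioo 0 T, φ t • h t := by
    rw [← integral_neg]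
    refine setIntegral_congr_fun measurableSet_Ioo fun s hs => ?_
    have h4 : Ioo 0 T ∩ Ioi s = Ioo s T := by
      ext t; simp only [mem_inter_iff, mem_Ioo, mem_Ioi]
      exact ⟨fun h => ⟨h.2, h.1.2⟩, fun h => ⟨⟨hs.1.trans h.1, h.2⟩, h.1⟩⟩
    have h5 : ∫ t in Ioo 0 T, F t s = ∫ t in Ioo s T, deriv φ t • h s := by
      rw [← h4, ← setIntegral_indicator measurableSet_Ioi]
      rfl
    change ∫ t in Ioo 0 T, F t s = _
    rw [h5, integral_smul_const, ← integral_Ioc_eq_integral_Ioo,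
      ← intervalIntegral.integral_of_le hs.2.le, intervalIntegral.integral_eq_sub_of_hasDerivAt
        (fun t _ => (hφ.differentiable (by simp)).differentiableAt.hasDerivAt)
        (hφ'.intervalIntegrable _ _), hφT, zero_sub, neg_smul]
  rw [← h2, h1, h3]

/-- A function whose integral vanishes against all derivatives of test functions is constant. -/
theorem exists_ae_eq_const_of_integral_deriv_smul (hT : 0 < T) {d : ℝ → ℂ}
    (hd : Integrable d (volume.restrict (Ioo 0 T)))
    (h : ∀ φ : ℝ → ℝ, ContDiff ℝ ∞ φ → HasCompactSupport φ → tsupport φ ⊆ Ioo 0 T →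
      ∫ t in Ioo 0 T, deriv φ t • d t = 0) :
    ∃ c : ℂ, d =ᵐ[volume.restrict (Ioo 0 T)] fun _ => c := by
  let β : ContDiffBump (T / 2 : ℝ) := ⟨T / 8, T / 4, by positivity, by linarith⟩
  set θ : ℝ → ℝ := β.normed volume with hθ
  have hθs : ContDiff ℝ ∞ θ := β.contDiff_normed
  have hθc : HasCompactSupport θ := β.hasCompactSupport_normed
  have hθ1 : ∫ t, θ t = 1 := β.integral_normed
  have hθt : tsupport θ ⊆ Icc (T / 4) (3 * T / 4) := by
    rw [hθ, β.tsupport_normed_eq, Real.closedBall_eq_Icc]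
    apply Icc_subset_Icc <;> simp only [β] <;> linarith
  refine ⟨∫ t in Ioo 0 T, θ t • d t, ?_⟩
  set c := ∫ t in Ioo 0 T, θ t • d t with hc
  have hdc : Integrable (fun t => d t - c) (volume.restrict (Ioo 0 T)) :=
    hd.sub (integrable_const c)
  have key := isOpen_Ioo.ae_eq_zero_of_integral_contDiff_smul_eq_zero (μ := volume)
    (f := fun t => d t - c) (U := Ioo 0 T) (IntegrableOn.locallyIntegrableOn hdc) ?_
  · rw [Filter.EventuallyEq, ae_restrict_iff' measurableSet_Ioo]
    filter_upwards [key] with t ht htT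
    exact sub_eq_zero.1 (ht htT)
  intro ψ hψs hψc hψt
  set I : ℝ := ∫ t, ψ t with hI
  -- the primitive of `ψ - I θ` is a test function
  obtain ⟨a, b, ha, hb, haθ, hbθ, hψab⟩ : ∃ a b : ℝ, 0 < a ∧ b < T ∧ a ≤ T / 4 ∧ 3 * T / 4 ≤ b ∧
      tsupport ψ ⊆ Icc a b := by
    rcases (tsupport ψ).eq_empty_or_nonempty with he | hne
    · exact ⟨T / 4, 3 * T / 4, by positivity, by linarith, le_rfl, le_rfl, by simp [he]⟩
    · have h1 := hψt (hψc.isCompact.sInf_mem hne)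
      have h2 := hψt (hψc.isCompact.sSup_mem hne)
      refine ⟨min (sInf (tsupport ψ)) (T / 4), max (sSup (tsupport ψ)) (3 * T / 4),
        lt_min h1.1 (by positivity), max_lt h2.2 (by linarith), min_le_right _ _,
        le_max_right _ _, fun t ht => ⟨?_, ?_⟩⟩
      · exact (min_le_left _ _).trans (csInf_le hψc.isCompact.bddBelow ht)
      · exact (le_csSup hψc.isCompact.bddAbove ht).trans (le_max_left _ _)
  have hθab : tsupport θ ⊆ Icc a b := hθt.trans (Icc_subset_Icc haθ hbθ)
  set g : ℝ → ℝ := fun t => ψ t - I * θ t with hg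
  have hgs : ContDiff ℝ ∞ g := hψs.sub (contDiff_const.mul hθs)
  have hg0 : ∀ t, t ∉ Icc a b → g t = 0 := fun t ht => by
    rw [hg]
    simp only
    rw [image_eq_zero_of_notMem_tsupport fun h => ht (hψab h),
      image_eq_zero_of_notMem_tsupport fun h => ht (hθab h), mul_zero, sub_zero]
  have hab : a ≤ b := by linarith
  have hgi : ∀ x y : ℝ, IntervalIntegrable g volume x y :=
    fun x y => hgs.continuous.intervalIntegrable x y
  have hgint : ∫ t in a..b, g t = 0 := by
    have h1 : ∫ t, g t = 0 := by
      rw [hg, integral_sub (hψs.continuous.integrable_of_hasCompactSupport hψc)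
        ((hθs.continuous.integrable_of_hasCompactSupport hθc).const_mul I), integral_const_mul, hθ1,
        mul_one, sub_self]
    rw [intervalIntegral.integral_of_le hab, ← integral_Icc_eq_integral_Ioc,
      setIntegral_eq_integral_of_forall_compl_eq_zero hg0, h1]
  set φ : ℝ → ℝ := fun t => ∫ s in a..t, g s with hφ
  have hφd : ∀ t, HasDerivAt φ (g t) t := fun t =>
    intervalIntegral.integral_hasDerivAt_right (hgi _ _)
      (hgs.continuous.stronglyMeasurableAtFilter _ _) hgs.continuous.continuousAt
  have hφderiv : deriv φ = g := funext fun t => (hφd t).deriv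
  have hφs : ContDiff ℝ ∞ φ := by
    rw [contDiff_infty_iff_deriv, hφderiv]
    exact ⟨fun t => (hφd t).differentiableAt, hgs⟩
  have hφ0 : ∀ t, t ∉ Icc a b → φ t = 0 := fun t ht => by
    rcases lt_or_ge t a with h1 | h1
    · rw [hφ]
      simp only
      rw [intervalIntegral.integral_symm, neg_eq_zero]
      refine intervalIntegral.integral_zero_ae ?_
      filter_upwards [(measure_eq_zero_iff_ae_notMem (μ := volume) (s := {a})).1 (by simp)]
        with s hs hs2
      rw [uIoc_of_le h1.le] at hs2
      exact hg0 s fun h => hs (le_antisymm hs2.2 h.1)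
    · have h2 : b < t := by
        by_contra h3
        exact ht ⟨h1, not_lt.1 h3⟩
      rw [hφ]
      simp only
      rw [← intervalIntegral.integral_add_adjacent_intervals (hgi a b) (hgi b t), hgint, zero_add]
      refine intervalIntegral.integral_zero_ae (.of_forall fun s hs => ?_)
      rw [uIoc_of_le h2.le] at hs
      exact hg0 s fun h => hs.1.not_ge h.2
  have hφt : tsupport φ ⊆ Icc a b :=
    closure_minimal (fun t ht => by by_contra h1; exact ht (hφ0 t h1)) isClosed_Icc
  have h1 := h φ hφs (HasCompactSupport.intro isCompact_Icc hφ0)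
    (hφt.trans (Icc_subset_Ioo ha hb))
  rw [hφderiv] at h1
  have h2 : ∫ t in Ioo 0 T, ψ t • d t = I • c := by
    have h3 : ∫ t in Ioo 0 T, g t • d t
        = (∫ t in Ioo 0 T, ψ t • d t) - I • ∫ t in Ioo 0 T, θ t • d t := by
      have h4 : Integrable (fun t => I • θ t • d t) (volume.restrict (Ioo 0 T)) :=
        (integrable_continuous_smul hθs.continuous hd).smul I
      rw [← integral_smul, ← integral_sub (integrable_continuous_smul hψs.continuous hd) h4]
      congr 1 with t
      rw [hg]
      simp only
      rw [sub_smul, mul_smul]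
    rw [h3, sub_eq_zero] at h1
    rw [h1, hc]
  have h4 : ∫ t, ψ t • (d t - c) = ∫ t in Ioo 0 T, ψ t • (d t - c) := by
    refine (setIntegral_eq_integral_of_forall_compl_eq_zero fun t ht => ?_).symm
    rw [image_eq_zero_of_notMem_tsupport fun h => ht (hψt h), zero_smul]
  have h5 : ∫ t in Ioo 0 T, ψ t • c = I • c := by
    rw [integral_smul_const, setIntegral_eq_integral_of_forall_compl_eq_zero fun t ht => ?_]
    exact image_eq_zero_of_notMem_tsupport fun h => ht (hψt h)
  simp only [smul_sub] at h4 ⊢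
  have h6 : Integrable (fun t => ψ t • c) (volume.restrict (Ioo 0 T)) := by
    refine Integrable.smul_const ?_ c
    exact (hψs.continuous.integrable_of_hasCompactSupport hψc).integrableOn
  rw [h4, integral_sub (integrable_continuous_smul hψs.continuous hd) h6, h2, h5, sub_self]

/-- A function with a weak derivative in `L²(0,T)` is a primitive of that derivative. -/
theorem HasL2WeakDeriv.exists_toLp_eq (hT : 0 < T) {y y' : ℝ → ℂ} (h : HasL2WeakDeriv T y y') :
    ∃ c : ℂ, h.mem.toLp = c • ofCont T 1 + volterra T h.mem_deriv.toLp := by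
  have hV := coeFn_volterra_toLp h.mem_deriv
  have hVi : Integrable (volterra T h.mem_deriv.toLp) (volume.restrict (Ioo 0 T)) :=
    integrable_of_memLp_two (Lp.memLp _)
  have hyi := integrable_of_memLp_two h.mem
  obtain ⟨c, hc⟩ := exists_ae_eq_const_of_integral_deriv_smul hT
    (d := fun t => y t - volterra T h.mem_deriv.toLp t) (hyi.sub hVi) (fun φ h1 h2 h3 => by
      have hφ' : Continuous (deriv φ) := h1.continuous_deriv (by simp)
      have h4 : φ T = 0 := image_eq_zero_of_notMem_tsupport fun h => lt_irrefl T (h3 h).2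
      have h5 := integral_deriv_mul_primitive h1 h4 (integrable_of_memLp_two h.mem_deriv)
      have h6 : ∫ t in Ioo 0 T, deriv φ t • volterra T h.mem_deriv.toLp t
          = ∫ t in Ioo 0 T, deriv φ t • ∫ s in (0 : ℝ)..t, y' s := by
        refine integral_congr_ae ?_
        filter_upwards [hV] with t ht
        rw [ht]
      simp only [smul_sub]
      rw [integral_sub (integrable_continuous_smul hφ' hyi) (integrable_continuous_smul hφ' hVi), h6, h5, h.integral_eq φ h1 h2 h3, sub_self])
  refine ⟨c, Lp.ext ?_⟩
  filter_upwards [hc, h.mem.coeFn_toLp, coeFn_ofCont (T := T) 1,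
    Lp.coeFn_add (c • ofCont T 1) (volterra T h.mem_deriv.toLp),
    Lp.coeFn_smul c (ofCont T 1)] with t h1 h2 h3 h4 h5
  rw [h4, h2, Pi.add_apply, h5, Pi.smul_apply, h3, ContinuousMap.one_apply, smul_eq_mul, mul_one]
  exact eq_add_of_sub_eq h1

/-- The convolution with a kernel in `H²(0,T)` is of the form treated in `memoryOp`. -/
theorem MemH2.exists_memoryOp (hT : 0 < T) {M : ℝ → ℂ} (hM : MemH2 T M) :
    ∃ (hM2 : MemLp M 2 (volume.restrict (Ioo 0 T))) (m₀ m₁ : ℂ) (m : L2 T),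
      memoryOp m₀ m₁ m = 1 - convL T hM2.toLp := by
  obtain ⟨M', M'', h1, h2⟩ := hM
  obtain ⟨m₀, e1⟩ := h1.exists_toLp_eq hT
  obtain ⟨m₁, e2⟩ := h2.exists_toLp_eq hT
  refine ⟨h1.mem, m₀, m₁, h2.mem_deriv.toLp, ?_⟩
  have e3 : (h1.mem_deriv.toLp : L2 T) = m₁ • ofCont T 1 + volterra T h2.mem_deriv.toLp := e2
  rw [memoryOp, e1, e3, map_add, map_smul, convL_volterra, map_add, map_smul, convL_volterra]
  simp only [mul_add, mul_smul_comm, mul_one, pow_two, mul_assoc]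
  rfl

end WeakDerivative

end Viscoelastic

namespace Viscoelastic

section Components

variable {T : ℝ}

theorem memLp_of_continuousOn {E : Type*} [NormedAddCommGroup E] {g : ℝ → E}
    (hg : ContinuousOn g (Icc 0 T)) :
    MemLp g 2 (volume.restrict (Ioo 0 T)) := by
  obtain ⟨c, hc⟩ := isCompact_Icc.exists_bound_of_continuousOn hg
  refine MemLp.of_bound ((hg.mono Ioo_subset_Icc_self).aestronglyMeasurable measurableSet_Ioo) c ?_
  filter_upwards [ae_restrict_mem measurableSet_Ioo] with t ht
  exact hc t (Ioo_subset_Icc_self ht)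

theorem integral_eq_of_ae_eq {f g : ℝ → ℂ} (h : f =ᵐ[volume.restrict (Ioo 0 T)] g) {t : ℝ}
    (ht : t ∈ Ioo 0 T) : ∫ s in (0 : ℝ)..t, f s = ∫ s in (0 : ℝ)..t, g s := by
  rw [intervalIntegral.integral_of_le ht.1.le, intervalIntegral.integral_of_le ht.1.le,
    integral_Ioc_eq_integral_Ioo, integral_Ioc_eq_integral_Ioo]
  exact integral_congr_ae (ae_restrict_of_ae_restrict_of_subset (Ioo_subset_Ioo_right ht.2.le) h)

/-- A function vanishing at `0` is the Volterra operator applied to its derivative. -/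
theorem toLp_eq_volterra {f f' : ℝ → ℂ} {X : L2 T} (hX : X =ᵐ[volume.restrict (Ioo 0 T)] f')
    (hd : ∀ t ∈ Icc 0 T, HasDerivWithinAt f (f' t) (Icc 0 T) t) (h0 : f 0 = 0)
    (hf : MemLp f 2 (volume.restrict (Ioo 0 T))) : hf.toLp = volterra T X := by
  refine Lp.ext ?_
  filter_upwards [hf.coeFn_toLp, coeFn_volterra X, ae_restrict_mem measurableSet_Ioo]
    with t h1 h2 ht
  have hint : IntegrableOn f' (Ioo 0 T) := by
    have : IntegrableOn X (Ioo 0 T) := integrable_of_memLp_two (Lp.memLp X)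
    exact Integrable.congr this hX
  have hsub : Icc 0 t ⊆ Icc 0 T := Icc_subset_Icc_right ht.2.le
  rw [h1, h2, integral_eq_of_ae_eq hX ht, intervalIntegral.integral_eq_sub_of_hasDerivAt_of_le
    ht.1.le (f := f) (fun s hs => ((hd s (hsub hs)).continuousWithinAt).mono hsub)
    (fun s hs => (hd s (hsub (Ioo_subset_Icc_self hs))).hasDerivAt
      (Icc_mem_nhds hs.1 (hs.2.trans ht.2))), h0, sub_zero]
  rw [intervalIntegrable_iff_integrableOn_Ioo_of_le ht.1.le]
  exact hint.mono_set (Ioo_subset_Ioo_right ht.2.le)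

theorem exists_toLp_eq_of_contDiffOn (hT : 0 < T) {σ : ℝ → ℂ} (hσ : ContDiffOn ℝ 1 σ (Icc 0 T)) :
    ∃ s' : L2 T, (memLp_of_continuousOn hσ.continuousOn).toLp
      = σ 0 • ofCont T 1 + volterra T s' := by
  have hu := uniqueDiffOn_Icc hT
  have hc' : ContinuousOn (derivWithin σ (Icc 0 T)) (Icc 0 T) :=
    hσ.continuousOn_derivWithin hu le_rfl
  have hc : ContinuousOn (fun t => σ t - σ 0) (Icc 0 T) := hσ.continuousOn.sub continuousOn_const
  have h1 := toLp_eq_volterra (f := fun t => σ t - σ 0) (memLp_of_continuousOn hc').coeFn_toLp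
    (fun t ht => ((hσ.differentiableOn one_ne_zero t ht).hasDerivWithinAt).sub_const _)
    (sub_self _) (memLp_of_continuousOn hc)
  refine ⟨(memLp_of_continuousOn hc').toLp, ?_⟩
  rw [← h1]
  refine Lp.ext ?_
  filter_upwards [(memLp_of_continuousOn hσ.continuousOn).coeFn_toLp,
    (memLp_of_continuousOn hc).coeFn_toLp, coeFn_ofCont (T := T) 1,
    Lp.coeFn_add (σ 0 • ofCont T 1) (memLp_of_continuousOn hc).toLp,
    Lp.coeFn_smul (σ 0) (ofCont T 1)] with t h1 h2 h3 h4 h5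
  rw [h4, h1, Pi.add_apply, h5, Pi.smul_apply, h2, h3, ContinuousMap.one_apply, smul_eq_mul,
    mul_one, add_sub_cancel]

variable {H : Type*} [NormedAddCommGroup H] [InnerProductSpace ℂ H] {A : H →ₗ.[ℂ] H}

theorem hasDerivWithinAt_inner {w : ℝ → H} {w' : H} {s : Set ℝ} {t : ℝ} (v : H)
    (hw : HasDerivWithinAt w w' s t) :
    HasDerivWithinAt (fun r => inner ℂ v (w r)) (inner ℂ v w') s t :=
  ((innerSL ℂ v).restrictScalars ℝ).hasFDerivAt.comp_hasDerivWithinAt t hw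

/-- The components of a solution with respect to an eigenvector solve a scalar equation. -/
theorem IsSolution.component (hT : 0 < T) {M σ : ℝ → ℂ}
    (hM : MemLp M 2 (volume.restrict (Ioo 0 T))) (hσ : MemLp σ 2 (volume.restrict (Ioo 0 T)))
    {f : H} {u : ℝ → H} (hu : IsSolution A T M (fun t => σ t • f) 0 0 u) {v : H} {lam : ℝ}
    (hv : (v, (lam : ℂ) • v) ∈ A.graph) :
    ∃ z z' : L2 T, z =ᵐ[volume.restrict (Ioo 0 T)] (fun t => inner ℂ v (u t)) ∧
      z' =ᵐ[volume.restrict (Ioo 0 T)] (fun t => inner ℂ v (derivWithin u (Icc 0 T) t)) ∧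
      z = volterra T z' ∧
      z' = volterra T (-((lam : ℂ) • ((1 - convL T hM.toLp : L2 T →L[ℂ] L2 T) z))
        + inner ℂ v f • hσ.toLp) := by
  have huc := hu.contDiffOn.continuousOn
  have huc' : ContinuousOn (derivWithin u (Icc 0 T)) (Icc 0 T) :=
    hu.contDiffOn.continuousOn_derivWithin (uniqueDiffOn_Icc hT) le_rfl
  have hz : MemLp (fun t => inner ℂ v (u t)) 2 (volume.restrict (Ioo 0 T)) :=
    memLp_of_continuousOn (continuousOn_const.inner huc)
  have hz' : MemLp (fun t => inner ℂ v (derivWithin u (Icc 0 T) t)) 2 (volume.restrict (Ioo 0 T)) :=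
    memLp_of_continuousOn (continuousOn_const.inner huc')
  refine ⟨hz.toLp, hz'.toLp, hz.coeFn_toLp, hz'.coeFn_toLp, ?_, ?_⟩
  · refine toLp_eq_volterra hz'.coeFn_toLp (fun t ht => ?_) (by simp [hu.initial]) hz
    exact hasDerivWithinAt_inner v
      (hu.contDiffOn.differentiableOn one_ne_zero t ht).hasDerivWithinAt
  · obtain ⟨x, hx, hx'⟩ := (LinearPMap.mem_graph_iff A).1 hv
    simp only at hx hx'
    refine toLp_eq_volterra (f' := fun t => -inner ℂ (A x) (u t)
      + (∫ s in (0 : ℝ)..t, M (t - s) * inner ℂ (A x) (u s)) + inner ℂ (x : H) (σ t • f)) ?_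
      (fun t ht => by rw [← hx]; exact hu.equation x t ht) (by simp [hu.initial_deriv]) hz'
    have h1 : ∀ y, inner ℂ (A x) y = (lam : ℂ) * inner ℂ v y := fun y => by
      rw [hx', inner_smul_left, Complex.conj_ofReal]
    have h2 : ∀ t, (∫ s in (0 : ℝ)..t, M (t - s) * inner ℂ (A x) (u s))
        = lam * ∫ s in (0 : ℝ)..t, M (t - s) * inner ℂ v (u s) := fun t => by
      rw [← intervalIntegral.integral_const_mul]
      congr 1 with s
      rw [h1]; ring
    simp only [h2]
    simp only [h1, hx, inner_smul_right]
    filter_upwards [Lp.coeFn_add (-((lam : ℂ) • ((1 - convL T hM.toLp : L2 T →L[ℂ] L2 T) hz.toLp)))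
        (inner ℂ v f • hσ.toLp), Lp.coeFn_smul (inner ℂ v f) hσ.toLp,
      Lp.coeFn_neg ((lam : ℂ) • ((1 - convL T hM.toLp : L2 T →L[ℂ] L2 T) hz.toLp)),
      Lp.coeFn_smul (lam : ℂ) ((1 - convL T hM.toLp : L2 T →L[ℂ] L2 T) hz.toLp),
      Lp.coeFn_sub hz.toLp (convL T hM.toLp hz.toLp), hz.coeFn_toLp, hσ.coeFn_toLp,
      coeFn_convL_toLp hM hz] with t e1 e2 e3 e4 e5 e6 e7 e8
    rw [e1, Pi.add_apply, e2, e3, Pi.neg_apply, e4, Pi.smul_apply, Pi.smul_apply, sub_apply,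
      one_apply_eq_self, e5, Pi.sub_apply, e6, e7, e8, smul_eq_mul, smul_eq_mul]
    ring

end Components

section Tensor

open scoped ENNReal

variable {T : ℝ} {G : Type*} [NormedAddCommGroup G] [InnerProductSpace ℂ G]

/-- The space `L²(0,T; G)`. -/
noncomputable abbrev L2G (T : ℝ) (G : Type*) [NormedAddCommGroup G] :=
  Lp G 2 (volume.restrict (Ioo 0 T))

/-- The bounded map `h ↦ h ⊗ g` from `L²(0,T)` to `L²(0,T; G)`. -/
noncomputable def tensorL (T : ℝ) (g : G) : L2 T →L[ℂ] L2G T G :=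
  (ContinuousLinearMap.toSpanSingleton ℂ g).compLpL 2 (volume.restrict (Ioo 0 T))

theorem coeFn_tensorL (g : G) (h : L2 T) :
    tensorL T g h =ᵐ[volume.restrict (Ioo 0 T)] fun t => h t • g :=
  ContinuousLinearMap.coeFn_compLpL _ _

theorem coeFn_tensorL_of_ae (g : G) {h : L2 T} {k : ℝ → ℂ}
    (hk : h =ᵐ[volume.restrict (Ioo 0 T)] k) :
    tensorL T g h =ᵐ[volume.restrict (Ioo 0 T)] fun t => k t • g := by
  filter_upwards [coeFn_tensorL g h, hk] with t h1 h2
  rw [h1, h2]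

theorem tensorL_add (g g' : G) (h : L2 T) :
    tensorL T (g + g') h = tensorL T g h + tensorL T g' h := by
  refine Lp.ext ?_
  filter_upwards [coeFn_tensorL (g + g') h, coeFn_tensorL g h, coeFn_tensorL g' h,
    Lp.coeFn_add (tensorL T g h) (tensorL T g' h)] with t h1 h2 h3 h4
  rw [h1, h4, Pi.add_apply, h2, h3, smul_add]

theorem tensorL_smul (c : ℂ) (g : G) (h : L2 T) : tensorL T (c • g) h = c • tensorL T g h := by
  refine Lp.ext ?_
  filter_upwards [coeFn_tensorL (c • g) h, coeFn_tensorL g h,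
    Lp.coeFn_smul c (tensorL T g h)] with t h1 h2 h3
  rw [h1, h3, Pi.smul_apply, h2, smul_comm]

theorem tensorL_sum {κ : Type*} (s : Finset κ) (g : κ → G) (h : L2 T) :
    tensorL T (∑ i ∈ s, g i) h = ∑ i ∈ s, tensorL T (g i) h := by
  classical
  induction s using Finset.induction_on with
  | empty =>
    have := tensorL_smul (T := T) 0 (0 : G) h
    simpa using this
  | insert i s hi ih => rw [Finset.sum_insert hi, Finset.sum_insert hi, tensorL_add, ih]

theorem inner_tensorL (g g' : G) (h h' : L2 T) :
    inner ℂ (tensorL T g h) (tensorL T g' h') = inner ℂ g g' * inner ℂ h h' := by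
  rw [L2.inner_def, L2.inner_def, ← integral_const_mul]
  refine integral_congr_ae ?_
  filter_upwards [coeFn_tensorL g h, coeFn_tensorL g' h'] with t h1 h2
  rw [h1, h2, inner_smul_left, inner_smul_right, RCLike.inner_apply]
  ring

theorem norm_sq_sum_tensorL {κ : Type*} [Fintype κ] {e : κ → G} (he : Orthonormal ℂ e)
    (h : κ → L2 T) : ‖∑ k, tensorL T (e k) (h k)‖ ^ 2 = ∑ k, ‖h k‖ ^ 2 := by
  classical
  have h1 : inner ℂ (∑ k, tensorL T (e k) (h k)) (∑ k, tensorL T (e k) (h k))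
      = ((∑ k, ‖h k‖ ^ 2 : ℝ) : ℂ) := by
    rw [sum_inner]
    push_cast
    refine Finset.sum_congr rfl fun k _ => ?_
    rw [inner_sum, Finset.sum_eq_single k]
    · rw [inner_tensorL, inner_self_eq_norm_sq_to_K, inner_self_eq_norm_sq_to_K, he.1 k]
      simp
    · intro l _ hl
      rw [inner_tensorL, he.2 (Ne.symm hl), zero_mul]
    · simp
  rw [inner_self_eq_norm_sq_to_K] at h1
  exact Complex.ofReal_injective ((Complex.ofReal_pow _ _).trans h1)

/-- A bounded operator on `L²(0,T)` acts on finite sums in `L²(0,T) ⊗ G` with the same bound. -/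
theorem norm_sum_tensorL_apply_le {κ : Type*} (S : L2 T →L[ℂ] L2 T) (s : Finset κ) (g : κ → G)
    (h : κ → L2 T) :
    ‖∑ i ∈ s, tensorL T (g i) (S (h i))‖ ≤ ‖S‖ * ‖∑ i ∈ s, tensorL T (g i) (h i)‖ := by
  classical
  let W : Submodule ℂ G := Submodule.span ℂ (s.image g : Set G)
  have hW : FiniteDimensional ℂ W := FiniteDimensional.span_finset ℂ _
  let e := stdOrthonormalBasis ℂ W
  have he : Orthonormal ℂ fun k => (e k : G) :=
    e.orthonormal.comp_linearIsometry W.subtypeₗᵢ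
  have hexp : ∀ i ∈ s, ∃ a : Fin (Module.finrank ℂ W) → ℂ, g i = ∑ k, a k • (e k : G) :=
    fun i hi => by
      have hgi : g i ∈ W := Submodule.subset_span (by
        rw [Finset.mem_coe]; exact Finset.mem_image_of_mem g hi)
      refine ⟨fun k => e.repr ⟨g i, hgi⟩ k, ?_⟩
      have := congrArg (fun x : W => (x : G)) (e.sum_repr ⟨g i, hgi⟩)
      simpa using this.symm
  choose! a ha using hexp
  have hsum : ∀ h' : κ → L2 T, ∑ i ∈ s, tensorL T (g i) (h' i)
      = ∑ k, tensorL T (e k : G) (∑ i ∈ s, a i k • h' i) := fun h' => by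
    simp only [map_sum, map_smul]
    rw [Finset.sum_comm]
    refine Finset.sum_congr rfl fun i hi => ?_
    conv_lhs => rw [ha i hi, tensorL_sum]
    simp only [tensorL_smul]
  refine le_of_sq_le_sq ?_ (by positivity)
  rw [mul_pow, hsum, hsum, norm_sq_sum_tensorL he, norm_sq_sum_tensorL he, Finset.mul_sum]
  refine Finset.sum_le_sum fun k _ => ?_
  have h1 : ∑ i ∈ s, a i k • S (h i) = S (∑ i ∈ s, a i k • h i) := by
    rw [map_sum]; simp only [map_smul]
  rw [h1, ← mul_pow]
  gcongr
  exact S.le_opNorm _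

end Tensor

end Viscoelastic

namespace Viscoelastic

section Oscillators

variable {T : ℝ}

/-- The functions `cos (√lam t)` and `sin (√lam t) / √lam`, for `lam` of any sign, with a bound which
is uniform for `lam ≥ -c`. -/
theorem exists_oscillator (c lam : ℝ) (hlam : -c ≤ lam) :
    ∃ C S : ℝ → ℝ, (∀ t, HasDerivAt S (C t) t) ∧ (∀ t, HasDerivAt C (-lam * S t) t) ∧
      C 0 = 1 ∧ S 0 = 0 ∧ ∀ t, 0 ≤ t → |C t| ≤ Real.exp (Real.sqrt c * t) := by
  rcases lt_trichotomy lam 0 with h | h | h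
  · set m := Real.sqrt (-lam) with hm
    have hm0 : 0 < m := Real.sqrt_pos.2 (by linarith)
    have hm2 : m * m = -lam := Real.mul_self_sqrt (by linarith)
    have hd : ∀ t, HasDerivAt (fun t => m * t) m t := fun t => by
      simpa using (hasDerivAt_id t).const_mul m
    refine ⟨fun t => Real.cosh (m * t), fun t => Real.sinh (m * t) / m, fun t => ?_, fun t => ?_,
      by simp, by simp, fun t ht => ?_⟩
    · have := ((hd t).sinh).div_const m
      rwa [mul_div_assoc, div_self hm0.ne', mul_one] at this
    · convert (hd t).cosh using 1
      field_simp
      rw [pow_two, hm2]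
      ring
    · rw [abs_of_pos (Real.cosh_pos _)]
      have h1 : m * t ≤ Real.sqrt c * t :=
        mul_le_mul_of_nonneg_right (Real.sqrt_le_sqrt (by linarith)) ht
      have h2 : Real.exp (-(m * t)) ≤ Real.exp (m * t) :=
        Real.exp_le_exp.2 (by nlinarith [mul_nonneg hm0.le ht])
      rw [Real.cosh_eq]
      have h3 := Real.exp_le_exp.2 h1
      linarith
  · refine ⟨fun _ => 1, fun t => t, fun t => hasDerivAt_id t, fun t => ?_, rfl, rfl, fun t ht => ?_⟩
    · rw [h]; simpa using hasDerivAt_const t (1 : ℝ)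
    · rw [abs_one]
      exact Real.one_le_exp (by positivity)
  · set m := Real.sqrt lam with hm
    have hm0 : 0 < m := Real.sqrt_pos.2 h
    have hm2 : m * m = lam := Real.mul_self_sqrt h.le
    have hd : ∀ t, HasDerivAt (fun t => m * t) m t := fun t => by
      simpa using (hasDerivAt_id t).const_mul m
    refine ⟨fun t => Real.cos (m * t), fun t => Real.sin (m * t) / m, fun t => ?_, fun t => ?_,
      by simp, by simp, fun t ht => ?_⟩
    · have := ((hd t).sin).div_const m
      rwa [mul_div_assoc, div_self hm0.ne', mul_one] at this
    · convert (hd t).cos using 1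
      field_simp
      rw [pow_two, hm2]
    · exact (Real.abs_cos_le_one _).trans (Real.one_le_exp (by positivity))

end Oscillators

section FiniteSums

variable {T : ℝ} {H G : Type*} [NormedAddCommGroup H] [InnerProductSpace ℂ H] [CompleteSpace H]
  [NormedAddCommGroup G] [InnerProductSpace ℂ G] {A : H →ₗ.[ℂ] H}
  {B : H →ₗ.[ℂ] G} {ι : Type*} {b : HilbertBasis ι ℂ H} {lam : ι → ℝ}

theorem starProjection_eigenspace_eq_zero (hA : IsSelfAdjoint A) {i : ι}
    (hb : (b i, (lam i : ℂ) • b i) ∈ A.graph) {μ : ℝ} (hμ : lam i ≠ μ) :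
    (eigenspace A μ).topologicalClosure.starProjection (b i) = 0 := by
  rw [Submodule.starProjection_apply_eq_zero_iff, Submodule.orthogonal_closure,
    Submodule.mem_orthogonal]
  intro x hx
  have hx' : (x, (μ : ℂ) • x) ∈ A.graph := hx
  have h1 := inner_graph_eq hA hx' hb
  simp only [inner_smul_left, inner_smul_right, Complex.conj_ofReal] at h1
  have h2 : ((μ - lam i : ℝ) : ℂ) * inner ℂ x (b i) = 0 := by
    push_cast
    rw [sub_mul, h1, sub_self]
  rcases mul_eq_zero.1 h2 with h3 | h3
  · exact absurd (sub_eq_zero.1 (Complex.ofReal_eq_zero.1 h3)).symm hμ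
  · exact h3

theorem memH1_sum (hA : IsSelfAdjoint A) (hb : ∀ i, (b i, (lam i : ℂ) • b i) ∈ A.graph)
    (s : Finset ι) (a : ι → ℂ) : MemH1 A (∑ i ∈ s, a i • b i) := by
  classical
  rw [MemH1, absForm, tsum_eq_sum (s := s.image lam)]
  · refine ENNReal.sum_ne_top.2 fun μ _ => ?_
    exact ENNReal.mul_ne_top ENNReal.ofReal_ne_top (ENNReal.pow_ne_top enorm_ne_top)
  · intro μ hμ
    have : (eigenspace A μ).topologicalClosure.starProjection (∑ i ∈ s, a i • b i) = 0 := by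
      rw [map_sum]
      refine Finset.sum_eq_zero fun i hi => ?_
      rw [map_smul, starProjection_eigenspace_eq_zero hA (hb i)
        (fun h => hμ (by rw [← h]; exact Finset.mem_image_of_mem lam hi)), smul_zero]
    rw [this]
    simp

theorem energyNorm_zero (x : H) : energyNorm A 0 x = ‖x‖ := by
  rw [energyNorm, absForm]
  simp [Real.sqrt_sq]

/-- Finite sums of eigenmodes solve the equation without memory. -/
theorem isSolution_sum (hT : 0 < T) (hA : IsSelfAdjoint A)
    (hb : ∀ i, (b i, (lam i : ℂ) • b i) ∈ A.graph) {C S : ι → ℝ → ℝ}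
    (hS : ∀ i t, HasDerivAt (S i) (C i t) t) (hC : ∀ i t, HasDerivAt (C i) (-lam i * S i t) t)
    (hC0 : ∀ i, C i 0 = 1) (hS0 : ∀ i, S i 0 = 0) (s : Finset ι) (a : ι → ℂ) :
    IsSolution A T (fun _ => 0) (fun _ => 0) 0 (∑ i ∈ s, a i • b i)
      (fun t => ∑ i ∈ s, (S i t : ℂ) • a i • b i) := by
  have hd : ∀ t, HasDerivAt (fun t => ∑ i ∈ s, (S i t : ℂ) • a i • b i)
      (∑ i ∈ s, (C i t : ℂ) • a i • b i) t := fun t =>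
    HasDerivAt.fun_sum fun i _ => ((hS i t).ofReal_comp).smul_const _
  have hd' : ∀ t, HasDerivAt (fun t => ∑ i ∈ s, (C i t : ℂ) • a i • b i)
      (∑ i ∈ s, ((-lam i * S i t : ℝ) : ℂ) • a i • b i) t := fun t =>
    HasDerivAt.fun_sum fun i _ => ((hC i t).ofReal_comp).smul_const _
  have hw : ∀ t ∈ Icc 0 T, derivWithin (fun t => ∑ i ∈ s, (S i t : ℂ) • a i • b i) (Icc 0 T) t
      = ∑ i ∈ s, (C i t : ℂ) • a i • b i := fun t ht =>
    (hd t).hasDerivWithinAt.derivWithin (uniqueDiffOn_Icc hT t ht)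
  refine ⟨?_, by simp [hS0], ?_, fun v t ht => ?_⟩
  · refine ContDiff.contDiffOn ?_
    rw [contDiff_one_iff_deriv]
    refine ⟨fun t => (hd t).differentiableAt, ?_⟩
    rw [funext fun t => (hd t).deriv]
    exact continuous_iff_continuousAt.2 fun t => (hd' t).continuousAt
  · rw [hw 0 (left_mem_Icc.2 hT.le)]
    simp [hC0]
  · have h1 := hasDerivWithinAt_inner (v : H) (hd' t).hasDerivWithinAt (s := Icc 0 T)
    have h2 := h1.congr (f₁ := fun r => inner ℂ (v : H) (derivWithin
      (fun t => ∑ i ∈ s, (S i t : ℂ) • a i • b i) (Icc 0 T) r)) (fun r hr => by rw [hw r hr])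
      (by rw [hw t ht])
    refine h2.congr_deriv (Eq.symm ?_)
    simp only [zero_mul, intervalIntegral.integral_zero, inner_zero_right, add_zero]
    rw [inner_sum, inner_sum, ← Finset.sum_neg_distrib]
    refine Finset.sum_congr rfl fun i _ => ?_
    have h3 := inner_graph_eq hA (LinearPMap.mem_graph A v) (hb i)
    simp only [inner_smul_right] at h3 ⊢
    rw [h3]
    push_cast
    ring

/-- Under the observability condition the eigenvectors belong to the domain of `B`, and the
observations of the sums of eigenmodes `S_i b_i` are equivalent to the norm of the initial velocity. -/
theorem ObservabilityRegularity.exists_sum_bounds (hT : 0 < T) (hA : IsSelfAdjoint A)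
    (hb : ∀ i, (b i, (lam i : ℂ) • b i) ∈ A.graph) {C S : ι → ℝ → ℝ}
    (hS : ∀ i t, HasDerivAt (S i) (C i t) t) (hC : ∀ i t, HasDerivAt (C i) (-lam i * S i t) t)
    (hC0 : ∀ i, C i 0 = 1) (hS0 : ∀ i, S i 0 = 0) {K : ℝ} (hB : ObservabilityRegularity A B T K)
    {h : ι → L2 T} (hh : ∀ i, h i =ᵐ[volume.restrict (Ioo 0 T)] fun t => (S i t : ℂ)) :
    ∃ β : ι → G, (∀ i, (b i, β i) ∈ B.graph) ∧ ∀ (s : Finset ι) (a : ι → ℂ),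
      K⁻¹ * ‖∑ i ∈ s, a i • b i‖ ≤ ‖∑ i ∈ s, tensorL T (a i • β i) (h i)‖ ∧
        ‖∑ i ∈ s, tensorL T (a i • β i) (h i)‖ ≤ K * ‖∑ i ∈ s, a i • b i‖ := by
  have hobs := fun (s : Finset ι) (a : ι → ℂ) => hB 0 (∑ i ∈ s, a i • b i) A.domain.zero_mem
    (memH1_sum hA hb s a) _ (isSolution_sum hT hA hb hS hC hC0 hS0 s a)
  have hβ : ∀ i, ∃ β : G, (b i, β) ∈ B.graph := fun i => by
    obtain ⟨y, hy, -⟩ := hobs {i} (fun _ => 1)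
    simp only [Finset.sum_singleton, one_smul] at hy
    have h1 : ∀ᶠ t in nhdsWithin (0 : ℝ) (Ioi 0), S i t ≠ 0 := by
      have h2 := (hS i 0).eventually_ne (c := 0) (by rw [hC0]; exact one_ne_zero)
      exact h2.filter_mono (nhdsWithin_mono _ fun t ht => ne_of_gt ht)
    obtain ⟨δ, hδ, h2⟩ := mem_nhdsGT_iff_exists_Ioo_subset.1 h1
    have h3 : ∃ t, t ∈ Ioo 0 (min δ T) ∧ ((S i t : ℂ) • b i, y t) ∈ B.graph := by
      have h4 : ∀ᵐ t ∂(volume.restrict (Ioo 0 (min δ T))),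
          ((S i t : ℂ) • b i, y t) ∈ B.graph :=
        ae_restrict_of_ae_restrict_of_subset (Ioo_subset_Ioo_right (min_le_right _ _)) hy
      have h5 : (ae (volume.restrict (Ioo 0 (min δ T)))).NeBot := by
        rw [ae_restrict_neBot]
        simp only [Real.volume_Ioo, sub_zero, ne_eq, ENNReal.ofReal_eq_zero, not_le]
        exact lt_min hδ hT
      obtain ⟨t, ht, ht'⟩ := (h4.and (ae_restrict_mem measurableSet_Ioo)).exists
      exact ⟨t, ht', ht⟩
    obtain ⟨t, ht, h4⟩ := h3
    have h5 : (S i t : ℂ) ≠ 0 :=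
      Complex.ofReal_ne_zero.2 (h2 ⟨ht.1, ht.2.trans_le (min_le_left _ _)⟩)
    refine ⟨(S i t : ℂ)⁻¹ • y t, ?_⟩
    have h6 := B.graph.smul_mem (S i t : ℂ)⁻¹ h4
    rwa [Prod.smul_mk, smul_smul, inv_mul_cancel₀ h5, one_smul] at h6
  choose β hβ using hβ
  refine ⟨β, hβ, fun s a => ?_⟩
  obtain ⟨y, hy, hy2, h1, h2⟩ := hobs s a
  have h3 : (∑ i ∈ s, tensorL T (a i • β i) (h i) : L2G T G) =ᵐ[volume.restrict (Ioo 0 T)] y := by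
    have h4 : ∀ i, tensorL T (a i • β i) (h i) =ᵐ[volume.restrict (Ioo 0 T)]
        fun t => (S i t : ℂ) • a i • β i := fun i => coeFn_tensorL_of_ae _ (hh i)
    have h5 : (∑ i ∈ s, tensorL T (a i • β i) (h i) : L2G T G) =ᵐ[volume.restrict (Ioo 0 T)]
        fun t => ∑ i ∈ s, (S i t : ℂ) • a i • β i := by
      refine (Lp.coeFn_fun_finsetSum _ _).trans ?_
      have := (Finset.eventually_all s).2 fun i _ => h4 i
      filter_upwards [this] with t ht
      exact Finset.sum_congr rfl fun i hi => ht i hi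
    filter_upwards [h5, hy] with t h6 h7
    rw [h6]
    refine LinearPMap.mem_graph_snd_inj B (x := ∑ i ∈ s, (S i t : ℂ) • a i • b i) ?_ h7 rfl
    have h8 := B.graph.sum_mem (t := s) fun i _ => B.graph.smul_mem (S i t : ℂ)
      (B.graph.smul_mem (a i) (hβ i))
    simpa [Prod.fst_sum, Prod.snd_sum, Prod.ext_iff] using h8
  have h4 : l2Norm T y = ‖∑ i ∈ s, tensorL T (a i • β i) (h i)‖ := by
    have h5 : ∫ t in Ioo 0 T, ‖y t‖ ^ 2 = ‖∑ i ∈ s, tensorL T (a i • β i) (h i)‖ ^ 2 := by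
      rw [norm_sq_eq_integral]
      refine integral_congr_ae ?_
      filter_upwards [h3] with t ht
      rw [ht]
    rw [l2Norm, h5, Real.sqrt_sq (norm_nonneg _)]
  rw [energyNorm_zero, h4] at h1 h2
  exact ⟨h1, h2⟩

end FiniteSums

end Viscoelastic

namespace Viscoelastic

section Summation

open Filter Topology

variable {ι E F : Type*} [NormedAddCommGroup E] [NormedAddCommGroup F] {a : ι → E} {b : ι → F}
  {x : E} {y : F} {c : ℝ}

theorem summable_of_norm_sum_le [CompleteSpace F] (hc : 0 ≤ c) (ha : HasSum a x)
    (h : ∀ s : Finset ι, ‖∑ i ∈ s, b i‖ ≤ c * ‖∑ i ∈ s, a i‖) : Summable b := by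
  classical
  rw [summable_iff_vanishing_norm]
  intro ε hε
  obtain ⟨s, hs⟩ := ha.summable.vanishing
    (Metric.ball_mem_nhds 0 (show 0 < ε / (c + 1) by positivity))
  refine ⟨s, fun t ht => (h t).trans_lt ?_⟩
  have h1 := mem_ball_zero_iff.1 (hs t ht)
  rw [lt_div_iff₀ (by positivity)] at h1
  nlinarith [norm_nonneg (∑ i ∈ t, a i)]

theorem norm_le_of_norm_sum_le (ha : HasSum a x) (hb : HasSum b y)
    (h : ∀ s : Finset ι, ‖∑ i ∈ s, b i‖ ≤ c * ‖∑ i ∈ s, a i‖) : ‖y‖ ≤ c * ‖x‖ :=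
  le_of_tendsto_of_tendsto' hb.norm (ha.norm.const_mul c) h

theorem tendsto_sum_subtype (ha : HasSum a x) {Z : Set ι} (hZ : ∀ i ∉ Z, a i = 0)
    {s : ℕ → Finset Z} (hs : Tendsto s atTop atTop) :
    Tendsto (fun n => ∑ i ∈ s n, a i) atTop (𝓝 x) := by
  have h1 := (hasSum_subtype_iff_of_support_subset (s := Z)
    (fun i hi => by_contra fun h => hi (hZ i h))).2 ha
  rw [HasSum, SummationFilter.unconditional_filter] at h1
  exact h1.comp hs

end Summation

section Observation

variable {T : ℝ} {H G : Type*} [NormedAddCommGroup H] [InnerProductSpace ℂ H]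
  [NormedAddCommGroup G] [InnerProductSpace ℂ G] {A : H →ₗ.[ℂ] H}
  {B : H →ₗ.[ℂ] G} {ι : Type*} {b : HilbertBasis ι ℂ H} {lam : ι → ℝ} {β : ι → G}

open Filter Topology

/-- If the expansions of `A u` and `B u` converge in `L²`, then the second one is an observation
of `u`. -/
theorem isObservation_of_hasSum
    (hB : IsClosed {p : (H × H) × G | p.1 ∈ A.graph ∧ (p.1.1, p.2) ∈ B.graph})
    (hb : ∀ i, (b i, (lam i : ℂ) • b i) ∈ A.graph) (hβ : ∀ i, (b i, β i) ∈ B.graph)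
    {u : ℝ → H} (hu : ContinuousOn u (Ioo 0 T)) {z : ι → L2 T}
    (hz : ∀ i, z i =ᵐ[volume.restrict (Ioo 0 T)] fun t => inner ℂ (b i) (u t))
    (hcount : (Function.support z).Countable) {y : L2G T G} {ξ : L2G T H}
    (hy : HasSum (fun i => tensorL T (β i) (z i)) y)
    (hξ : HasSum (fun i => tensorL T (b i) ((lam i : ℂ) • z i)) ξ) :
    IsObservation B T u y := by
  have : Countable (Function.support z) := hcount.to_subtype
  obtain ⟨s, hs⟩ := exists_seq_tendsto (atTop : Filter (Finset (Function.support z)))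
  have hy1 : Tendsto (fun n => ∑ i ∈ s n, tensorL T (β i) (z i)) atTop (𝓝 y) :=
    tendsto_sum_subtype hy (fun i hi => by rw [Function.notMem_support.1 hi, map_zero]) hs
  have hξ1 : Tendsto (fun n => ∑ i ∈ s n, tensorL T (b i) ((lam i : ℂ) • z i)) atTop (𝓝 ξ) :=
    tendsto_sum_subtype hξ
      (fun i hi => by rw [Function.notMem_support.1 hi, smul_zero, map_zero]) hs
  obtain ⟨n₁, hn₁, hy2⟩ := (tendstoInMeasure_of_tendsto_Lp hy1).exists_seq_tendsto_ae
  obtain ⟨n₂, hn₂, hξ2⟩ := (tendstoInMeasure_of_tendsto_Lp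
    (hξ1.comp hn₁.tendsto_atTop)).exists_seq_tendsto_ae
  have hzero : ∀ t ∈ Ioo 0 T, ∀ i ∉ Function.support z, inner ℂ (b i) (u t) = 0 :=
    fun t ht i hi => by
      have h1 := hz i
      rw [Function.notMem_support.1 hi] at h1
      exact (Measure.eqOn_open_of_ae_eq ((Lp.coeFn_zero ℂ 2 _).symm.trans h1) isOpen_Ioo
        continuousOn_const (continuousOn_const.inner hu) ht).symm
  have hz' : ∀ᵐ t ∂(volume.restrict (Ioo 0 T)), ∀ i : Function.support z,
      z i t = inner ℂ (b i) (u t) := ae_all_iff.2 fun i => hz i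
  have hy3 : ∀ᵐ t ∂(volume.restrict (Ioo 0 T)), ∀ n,
      (∑ i ∈ s n, tensorL T (β i) (z i) : L2G T G) t = ∑ i ∈ s n, z i t • β i :=
    ae_all_iff.2 fun n => by
      have h1 : ∀ᵐ t ∂(volume.restrict (Ioo 0 T)), ∀ i ∈ s n, tensorL T (β i) (z i) t
          = z i t • β i := (Finset.eventually_all _).2 fun i _ => coeFn_tensorL _ _
      filter_upwards [Lp.coeFn_fun_finsetSum (s n) fun i => tensorL T (β i) (z i), h1]
        with t h2 h3
      rw [h2]
      exact Finset.sum_congr rfl h3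
  have hξ3 : ∀ᵐ t ∂(volume.restrict (Ioo 0 T)), ∀ n,
      (∑ i ∈ s n, tensorL T (b i) ((lam i : ℂ) • z i) : L2G T H) t
        = ∑ i ∈ s n, z i t • (lam i : ℂ) • b i :=
    ae_all_iff.2 fun n => by
      have h1 : ∀ᵐ t ∂(volume.restrict (Ioo 0 T)), ∀ i ∈ s n,
          tensorL T (b i) ((lam i : ℂ) • z i) t = z i t • (lam i : ℂ) • b i :=
        (Finset.eventually_all _).2 fun i _ => by
          rw [map_smul, ← tensorL_smul]
          exact coeFn_tensorL _ _
      filter_upwards [Lp.coeFn_fun_finsetSum (s n) fun i => tensorL T (b i) ((lam i : ℂ) • z i),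
        h1] with t h2 h3
      rw [h2]
      exact Finset.sum_congr rfl h3
  unfold IsObservation
  filter_upwards [hy2, hξ2, hz', hy3, hξ3, ae_restrict_mem measurableSet_Ioo]
    with t h1 h2 h3 h4 h5 ht
  have h6 : Tendsto (fun n => ∑ i ∈ s n, z i t • b i) atTop (𝓝 (u t)) := by
    have h7 := b.hasSum_repr (u t)
    simp only [HilbertBasis.repr_apply_apply] at h7
    have h8 := tendsto_sum_subtype h7 (fun i hi => by rw [hzero t ht i hi, zero_smul]) hs
    simpa only [h3] using h8
  have h7 := h6.comp (hn₁.tendsto_atTop.comp hn₂.tendsto_atTop)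
  have h8 := h1.comp hn₂.tendsto_atTop
  simp only [Function.comp_def, h4, h5] at h2 h7 h8
  have h9 := (h7.prodMk_nhds h2).prodMk_nhds h8
  refine (hB.mem_of_tendsto h9 (Eventually.of_forall fun n => ⟨?_, ?_⟩)).2
  · have h10 := A.graph.sum_mem (t := s (n₁ (n₂ n))) fun i _ =>
      A.graph.smul_mem (z i t) (hb i)
    simpa [Prod.fst_sum, Prod.snd_sum, Prod.ext_iff] using h10
  · have h10 := B.graph.sum_mem (t := s (n₁ (n₂ n))) fun i _ =>
      B.graph.smul_mem (z i t) (hβ i)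
    simpa [Prod.fst_sum, Prod.snd_sum, Prod.ext_iff] using h10

end Observation

section WeakDerivative

variable {T : ℝ} {G : Type*} [NormedAddCommGroup G] [InnerProductSpace ℂ G] [CompleteSpace G]

theorem inner_tensorL_ofCont (g : G) (ψ : C(ℝ, ℝ)) (y : L2G T G) :
    inner ℂ (tensorL T g (ofCont T ((ContinuousMap.mk Complex.ofReal Complex.continuous_ofReal).comp ψ))) y
      = inner ℂ g (∫ t in Ioo 0 T, ψ t • y t) := by
  rw [← integral_inner (integrable_continuous_smul ψ.continuous
    (integrable_of_memLp_two (Lp.memLp y))), L2.inner_def]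
  refine integral_congr_ae ?_
  filter_upwards [coeFn_tensorL_of_ae g (coeFn_ofCont (T := T)
    ((ContinuousMap.mk Complex.ofReal Complex.continuous_ofReal).comp ψ))] with t ht
  rw [ht, ContinuousMap.comp_apply, ContinuousMap.coe_mk, inner_smul_left, Complex.conj_ofReal,
    ← Complex.coe_smul, inner_smul_right]

theorem hasL2WeakDeriv_of_hasSum {ι : Type*} {β : ι → G} {z' : ι → L2 T} {y y' : L2G T G}
    (hy : HasSum (fun i => tensorL T (β i) (volterra T (z' i))) y)
    (hy' : HasSum (fun i => tensorL T (β i) (z' i)) y') : HasL2WeakDeriv T y y' := by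
  refine ⟨Lp.memLp y, Lp.memLp y', fun φ h1 _ h3 => ?_⟩
  have h4 : φ T = 0 := by
    by_contra h
    exact lt_irrefl T (h3 (subset_tsupport _ h)).2
  have hφ' : Continuous (deriv φ) := h1.continuous_deriv (by simp)
  refine ext_inner_left ℂ fun g => ?_
  rw [inner_neg_right]
  have e1 := inner_tensorL_ofCont g ⟨deriv φ, hφ'⟩ y
  have e2 := inner_tensorL_ofCont g ⟨φ, h1.continuous⟩ y'
  simp only [ContinuousMap.coe_mk] at e1 e2
  rw [← e1, ← e2]
  have s1 := (innerSL ℂ (tensorL T g (ofCont T ((ContinuousMap.mk Complex.ofReal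
    Complex.continuous_ofReal).comp ⟨deriv φ, hφ'⟩)))).hasSum hy
  have s2 := ((innerSL ℂ (tensorL T g (ofCont T ((ContinuousMap.mk Complex.ofReal
    Complex.continuous_ofReal).comp ⟨φ, h1.continuous⟩)))).hasSum hy').neg
  simp only [innerSL_apply_apply] at s1 s2
  refine s1.unique (s2.congr_fun fun i => ?_)
  rw [inner_tensorL_ofCont, inner_tensorL_ofCont, ← inner_neg_right]
  congr 1
  simp only [ContinuousMap.coe_mk]
  have hint := integrable_of_memLp_two (Lp.memLp (z' i))
  have h5 : ∀ (ψ : ℝ → ℝ) (k : L2 T) (k' : ℝ → ℂ), k =ᵐ[volume.restrict (Ioo 0 T)] k' →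
      ∫ t in Ioo 0 T, ψ t • tensorL T (β i) k t = (∫ t in Ioo 0 T, ψ t • k' t) • β i :=
    fun ψ k k' hk => by
      rw [← integral_smul_const]
      refine integral_congr_ae ?_
      filter_upwards [coeFn_tensorL_of_ae (β i) hk] with t ht
      rw [ht, smul_assoc]
  rw [h5 _ _ _ (coeFn_volterra _), h5 _ _ _ (Filter.EventuallyEq.refl _ _), ← neg_smul,
    integral_deriv_mul_primitive h1 h4 hint]

end WeakDerivative

section Modes

variable {T : ℝ} {ι : Type*}

theorem exists_modes {lam : ι → ℝ} {c : ℝ} (hlam : ∀ i, -c ≤ lam i) :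
    ∃ C S : ι → ℝ → ℝ, (∀ i t, HasDerivAt (S i) (C i t) t) ∧
      (∀ i t, HasDerivAt (C i) (-lam i * S i t) t) ∧ (∀ i, C i 0 = 1) ∧ (∀ i, S i 0 = 0) ∧
      ∃ (R : ℝ) (cc : ι → L2 T), 0 ≤ R ∧ ∀ i, ‖cc i‖ ≤ R ∧
        volterra T (cc i) =ᵐ[volume.restrict (Ioo 0 T)] (fun t => (S i t : ℂ)) ∧
        cc i + (lam i : ℂ) • volterra T (volterra T (cc i)) = ofCont T 1 := by
  choose C S hS hC hC0 hS0 hbd using fun i => exists_oscillator c (lam i) (hlam i)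
  refine ⟨C, S, hS, hC, hC0, hS0, ?_⟩
  have hCc : ∀ i, Continuous fun t => (C i t : ℂ) := fun i => Complex.continuous_ofReal.comp
    (continuous_iff_continuousAt.2 fun t => (hC i t).continuousAt)
  have hSc : ∀ i, Continuous fun t => (S i t : ℂ) := fun i => Complex.continuous_ofReal.comp
    (continuous_iff_continuousAt.2 fun t => (hS i t).continuousAt)
  have hSm : ∀ i, MemLp (fun t => (S i t : ℂ)) 2 (volume.restrict (Ioo 0 T)) := fun i =>
    memLp_of_continuousOn (hSc i).continuousOn
  have hC1c : ∀ i, ContinuousOn (fun t => ((C i t - 1 : ℝ) : ℂ)) (Icc 0 T) := fun i => by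
    push_cast
    exact ((hCc i).sub continuous_const).continuousOn
  have hV : ∀ i, (hSm i).toLp = volterra T (ofCont T ⟨fun t => (C i t : ℂ), hCc i⟩) := fun i =>
    toLp_eq_volterra (coeFn_ofCont _)
      (fun t _ => ((hS i t).ofReal_comp).hasDerivWithinAt) (by simp [hS0]) (hSm i)
  refine ⟨(measureUnivNNReal (volume.restrict (Ioo 0 T)) : ℝ) ^ (2 : ENNReal).toReal⁻¹
    * Real.exp (Real.sqrt c * T), fun i => ofCont T ⟨fun t => (C i t : ℂ), hCc i⟩,
    by positivity, fun i => ⟨?_, ?_, ?_⟩⟩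
  · refine Lp.norm_le_of_ae_bound (Real.exp_nonneg _) ?_
    filter_upwards [coeFn_ofCont (T := T) ⟨fun t => (C i t : ℂ), hCc i⟩,
      ae_restrict_mem measurableSet_Ioo] with t h1 ht
    rw [h1, ContinuousMap.coe_mk, Complex.norm_real, Real.norm_eq_abs]
    refine (hbd i t ht.1.le).trans (Real.exp_le_exp.2 ?_)
    exact mul_le_mul_of_nonneg_left ht.2.le (Real.sqrt_nonneg _)
  · rw [← hV]
    exact (hSm i).coeFn_toLp
  · have h1 := toLp_eq_volterra (f := fun t => ((C i t - 1 : ℝ) : ℂ))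
      (f' := fun t => ((-lam i * S i t : ℝ) : ℂ)) (X := (-lam i : ℂ) • (hSm i).toLp) (by
        filter_upwards [Lp.coeFn_smul (-lam i : ℂ) (hSm i).toLp, (hSm i).coeFn_toLp] with t e1 e2
        rw [e1, Pi.smul_apply, e2]
        simp) (fun t _ => (((hC i t).sub_const 1).ofReal_comp).hasDerivWithinAt) (by simp [hC0])
      (memLp_of_continuousOn (hC1c i))
    have h2 : ofCont T ⟨fun t => (C i t : ℂ), hCc i⟩
        = ofCont T 1 + (memLp_of_continuousOn (hC1c i)).toLp := by
      refine Lp.ext ?_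
      filter_upwards [coeFn_ofCont (T := T) ⟨fun t => (C i t : ℂ), hCc i⟩,
        coeFn_ofCont (T := T) 1, (memLp_of_continuousOn (hC1c i)).coeFn_toLp,
        Lp.coeFn_add (ofCont T 1) (memLp_of_continuousOn (hC1c i)).toLp] with t e1 e2 e3 e4
      rw [e1, e4, Pi.add_apply, e2, e3]
      simp
    beta_reduce
    rw [← hV]
    rw [h2, h1]
    rw [map_smul]
    module

end Modes

end Viscoelastic

namespace Viscoelastic

section Components

variable {T : ℝ} {H : Type*} [NormedAddCommGroup H] [InnerProductSpace ℂ H]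

/-- The components of the derivatives of all solutions are the images under one invertible operator of
the solutions of the equation without memory. -/
theorem exists_component_transmutation (hT : 0 < T) {M σ : ℝ → ℂ} (hM : MemH2 T M)
    (hσ : ContDiffOn ℝ 1 σ (Icc 0 T)) (hσ0 : σ 0 ≠ 0) (A : H →ₗ.[ℂ] H) :
    ∃ Y : L2 T →L[ℂ] L2 T, IsUnit Y ∧ ∃ K : ℝ, 0 ≤ K ∧ ∀ (f : H) (u : ℝ → H),
      IsSolution A T M (fun t => σ t • f) 0 0 u → ∀ (v : H) (lam : ℝ) (c : L2 T),
      (v, (lam : ℂ) • v) ∈ A.graph →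
      c + (lam : ℂ) • volterra T (volterra T c) = ofCont T 1 →
      ∃ z z' : L2 T, z =ᵐ[volume.restrict (Ioo 0 T)] (fun t => inner ℂ v (u t)) ∧
        z = volterra T z' ∧ z' = inner ℂ v f • Y (volterra T c) ∧
        ‖(lam : ℂ) • z‖ ≤ K * (1 + ‖c‖) * ‖(inner ℂ v f : ℂ)‖ := by
  obtain ⟨hM2, m₀, m₁, m, hm⟩ := hM.exists_memoryOp hT
  obtain ⟨s', hs'⟩ := exists_toLp_eq_of_contDiffOn hT hσ
  obtain ⟨Y, hY, K, hK, h⟩ := exists_memory_transmutation m₀ m₁ m hσ0 s'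
  refine ⟨Y, hY, K, hK, fun f u hu v lam c hv hc => ?_⟩
  obtain ⟨z, z', h1, -, h2, h3⟩ := hu.component hT hM2 (memLp_of_continuousOn hσ.continuousOn) hv
  rw [← hm, hs'] at h3
  exact ⟨z, z', h1, h2, h (lam : ℂ) (inner ℂ v f) c z z' hc h2 h3⟩

end Components

section Norms

variable {T : ℝ} {G : Type*} [NormedAddCommGroup G] [InnerProductSpace ℂ G]

theorem l2Norm_coe (y : L2G T G) : l2Norm T y = ‖y‖ := by
  rw [l2Norm, ← norm_sq_eq_integral, Real.sqrt_sq (norm_nonneg _)]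

theorem norm_sum_tensorL_le_of_orthonormal {ι : Type*} {e : ι → G} (he : Orthonormal ℂ e)
    {h : ι → L2 T} {a : ι → ℂ} {c : ℝ} (hc : 0 ≤ c) (hle : ∀ i, ‖h i‖ ≤ c * ‖a i‖)
    (s : Finset ι) : ‖∑ i ∈ s, tensorL T (e i) (h i)‖ ≤ c * ‖∑ i ∈ s, a i • e i‖ := by
  have he' : Orthonormal ℂ fun i : s => e i := he.comp _ Subtype.val_injective
  have h1 : ‖∑ i ∈ s, a i • e i‖ ^ 2 = ∑ i : s, ‖a i‖ ^ 2 := by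
    rw [Finset.sum_coe_sort s fun i => ‖a i‖ ^ 2, ← inner_self_eq_norm_sq (𝕜 := ℂ),
      he.inner_sum]
    simp [← Complex.normSq_eq_conj_mul_self, Complex.normSq_eq_norm_sq, -Complex.ofReal_pow]
  refine le_of_sq_le_sq ?_ (by positivity)
  rw [mul_pow, h1, ← Finset.sum_coe_sort s fun i => tensorL T (e i) (h i),
    norm_sq_sum_tensorL he', Finset.mul_sum]
  refine Finset.sum_le_sum fun i _ => ?_
  rw [← mul_pow]
  exact pow_le_pow_left₀ (norm_nonneg _) (hle i) 2

end Norms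

section Main

variable {H G : Type*} [NormedAddCommGroup H] [InnerProductSpace ℂ H] [CompleteSpace H]
    [NormedAddCommGroup G] [InnerProductSpace ℂ G] [CompleteSpace G]
    {A : H →ₗ.[ℂ] H} {B : H →ₗ.[ℂ] G} {T₀ T : ℝ} {M σ : ℝ → ℂ}

/-- The two-sided estimate, with the constants on both sides separated. -/
theorem exists_source_bounds (hA : ConditionA A) (hB : ConditionB A B T₀) (hM : MemH2 T M)
    (hσ : ContDiffOn ℝ 1 σ (Icc 0 T)) (hσ0 : σ 0 ≠ 0) (hT : T₀ < T) :
    ∃ C₁ C₂ C₃ : ℝ, 0 ≤ C₁ ∧ 0 ≤ C₂ ∧ 0 ≤ C₃ ∧ ∀ (f : H) (u : ℝ → H),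
      IsSolution A T M (fun t => σ t • f) 0 0 u →
      ∃ y y' : L2G T G, IsObservation B T u y ∧ HasL2WeakDeriv T y y' ∧
        ‖f‖ ≤ C₁ * ‖y'‖ ∧ ‖y'‖ ≤ C₂ * ‖f‖ ∧ ‖y‖ ≤ C₃ * ‖f‖ := by
  have hT0 : 0 < T := hB.nonneg.trans_lt hT
  obtain ⟨ι, b, lam, c, -, hb⟩ := hA.exists_eigenbasis
  obtain ⟨C, S, hS, hC, hC0, hS0, R, cc, hR, hcc⟩ :=
    exists_modes (T := T) (lam := lam) (c := c) fun i => (hb i).2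
  obtain ⟨D, hD, hobs⟩ := hB.observability T hT
  obtain ⟨β, hβ, hbound⟩ := hobs.exists_sum_bounds hT0 hA.selfAdjoint (fun i => (hb i).1)
    hS hC hC0 hS0 (h := fun i => volterra T (cc i)) fun i => (hcc i).2.1
  obtain ⟨Y, hY, K, hK, hcomp⟩ := exists_component_transmutation hT0 hM hσ hσ0 A
  obtain ⟨Y, rfl⟩ := hY
  refine ⟨D * ‖(↑Y⁻¹ : L2 T →L[ℂ] L2 T)‖, ‖(Y : L2 T →L[ℂ] L2 T)‖ * D,
    ‖volterra T‖ * (‖(Y : L2 T →L[ℂ] L2 T)‖ * D), by positivity, by positivity, by positivity,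
    fun f u hu => ?_⟩
  choose z z' hz hzz' hz' hlz using fun i => hcomp f u hu (b i) (lam i) (cc i) (hb i).1 (hcc i).2.2
  have hf : HasSum (fun i => (inner ℂ (b i) f : ℂ) • b i) f := by
    simpa only [HilbertBasis.repr_apply_apply] using b.hasSum_repr f
  have hten : ∀ i, tensorL T (β i) (z' i)
      = tensorL T ((inner ℂ (b i) f : ℂ) • β i) ((Y : L2 T →L[ℂ] L2 T) (volterra T (cc i))) :=
    fun i => by rw [hz', map_smul, tensorL_smul]
  have hup' : ∀ s : Finset ι, ‖∑ i ∈ s, tensorL T (β i) (z' i)‖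
      ≤ ‖(Y : L2 T →L[ℂ] L2 T)‖ * D * ‖∑ i ∈ s, (inner ℂ (b i) f : ℂ) • b i‖ := fun s => by
    simp only [hten]
    refine (norm_sum_tensorL_apply_le (Y : L2 T →L[ℂ] L2 T) s _ _).trans ?_
    rw [mul_assoc]
    exact mul_le_mul_of_nonneg_left (hbound s _).2 (norm_nonneg _)
  have hlow : ∀ s : Finset ι, ‖∑ i ∈ s, (inner ℂ (b i) f : ℂ) • b i‖
      ≤ D * ‖(↑Y⁻¹ : L2 T →L[ℂ] L2 T)‖ * ‖∑ i ∈ s, tensorL T (β i) (z' i)‖ := fun s => by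
    simp only [hten]
    have h1 := norm_sum_tensorL_apply_le (↑Y⁻¹ : L2 T →L[ℂ] L2 T) s
      (fun i => (inner ℂ (b i) f : ℂ) • β i)
      fun i => (Y : L2 T →L[ℂ] L2 T) (volterra T (cc i))
    have h2 : ∀ k, (↑Y⁻¹ : L2 T →L[ℂ] L2 T) ((Y : L2 T →L[ℂ] L2 T) k) = k := fun k =>
      congrArg (fun Z : L2 T →L[ℂ] L2 T => Z k) Y.inv_mul
    simp only [h2] at h1
    have h3 := (hbound s fun i => (inner ℂ (b i) f : ℂ)).1.trans h1
    rwa [inv_mul_le_iff₀ hD, ← mul_assoc] at h3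
  have hup : ∀ s : Finset ι, ‖∑ i ∈ s, tensorL T (β i) (volterra T (z' i))‖
      ≤ ‖volterra T‖ * (‖(Y : L2 T →L[ℂ] L2 T)‖ * D)
        * ‖∑ i ∈ s, (inner ℂ (b i) f : ℂ) • b i‖ := fun s => by
    refine (norm_sum_tensorL_apply_le _ s _ _).trans ?_
    rw [mul_assoc]
    exact mul_le_mul_of_nonneg_left (hup' s) (norm_nonneg _)
  have hgraph : ∀ s : Finset ι, ‖∑ i ∈ s, tensorL T (b i) ((lam i : ℂ) • z i)‖
      ≤ K * (1 + R) * ‖∑ i ∈ s, (inner ℂ (b i) f : ℂ) • b i‖ :=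
    norm_sum_tensorL_le_of_orthonormal b.orthonormal (by positivity) fun i => by
      refine (hlz i).trans ?_
      have := (hcc i).1
      gcongr
  obtain ⟨y', hy'⟩ := summable_of_norm_sum_le (by positivity) hf hup'
  obtain ⟨y, hy⟩ := summable_of_norm_sum_le (by positivity) hf hup
  obtain ⟨ξ, hξ⟩ := summable_of_norm_sum_le (by positivity) hf hgraph
  have hcount : (Function.support z).Countable := by
    refine hf.summable.countable_support.mono ?_
    refine Function.support_subset_iff'.2 fun i hi => ?_
    have h := Function.notMem_support.1 hi
    have h0 : (inner ℂ (b i) f : ℂ) = 0 :=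
      (smul_eq_zero.1 h).resolve_right (b.orthonormal.ne_zero i)
    rw [hzz', hz', h0, zero_smul, map_zero]
  refine ⟨y, y', ?_, hasL2WeakDeriv_of_hasSum hy hy', norm_le_of_norm_sum_le hy' hf hlow,
    norm_le_of_norm_sum_le hf hy' hup', norm_le_of_norm_sum_le hf hy hup⟩
  simp only [← hzz'] at hy
  exact isObservation_of_hasSum hB.closed (fun i => (hb i).1) hβ
    (hu.contDiffOn.continuousOn.mono Ioo_subset_Icc_self) hz hcount hy hξ

end Main

end Viscoelastic

theorem theorem1p2
    {H G : Type*} [NormedAddCommGroup H] [InnerProductSpace ℂ H] [CompleteSpace H]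
    [NormedAddCommGroup G] [InnerProductSpace ℂ G] [CompleteSpace G]
    (A : H →ₗ.[ℂ] H) (B : H →ₗ.[ℂ] G) (T₀ T : ℝ) (M σ : ℝ → ℂ)
    (hA : Viscoelastic.ConditionA A) (hB : Viscoelastic.ConditionB A B T₀)
    (hM : Viscoelastic.MemH2 T M)
    (hσ : ContDiffOn ℝ 1 σ (Set.Icc 0 T)) (hσ0 : σ 0 ≠ 0) (hT : T₀ < T) :
    ∃ C : ℝ, 0 < C ∧ ∀ (f : H) (u : ℝ → H),
      Viscoelastic.IsSolution A T M (fun t => σ t • f) 0 0 u →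
      ∃ y y' : ℝ → G, Viscoelastic.IsObservation B T u y ∧ Viscoelastic.HasL2WeakDeriv T y y' ∧
        C⁻¹ * ‖f‖ ≤ Viscoelastic.h1Norm T y y' ∧ Viscoelastic.h1Norm T y y' ≤ C * ‖f‖ := by
  obtain ⟨C₁, C₂, C₃, h1, h2, h3, h⟩ :=
    Viscoelastic.exists_source_bounds hA hB hM hσ hσ0 hT
  have hC : 0 < 1 + C₁ + C₂ + C₃ := by positivity
  refine ⟨1 + C₁ + C₂ + C₃, hC, fun f u hu => ?_⟩
  obtain ⟨y, y', hobs, hder, e1, e2, e3⟩ := h f u hu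
  refine ⟨y, y', hobs, hder, ?_, ?_⟩
  · rw [inv_mul_le_iff₀ hC, Viscoelastic.h1Norm, Viscoelastic.l2Norm_coe,
      Viscoelastic.l2Norm_coe]
    have e4 : ‖y'‖ ≤ Real.sqrt (‖y‖ ^ 2 + ‖y'‖ ^ 2) :=
      Real.le_sqrt_of_sq_le (by nlinarith [sq_nonneg ‖y‖])
    calc ‖f‖ ≤ C₁ * ‖y'‖ := e1
      _ ≤ (1 + C₁ + C₂ + C₃) * Real.sqrt (‖y‖ ^ 2 + ‖y'‖ ^ 2) := by
        gcongr
        linarith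
  · rw [Viscoelastic.h1Norm, Viscoelastic.l2Norm_coe, Viscoelastic.l2Norm_coe]
    refine (Real.sqrt_le_sqrt (y := (‖y‖ + ‖y'‖) ^ 2)
      (by nlinarith [norm_nonneg y, norm_nonneg y'])).trans ?_
    rw [Real.sqrt_sq (by positivity)]
    nlinarith [norm_nonneg f, mul_nonneg h1 (norm_nonneg f)]
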